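/- Let $\mathbb D=\{z\in\mathbb C:|z|<1\}$, let $\ell$ be normalised arc length on $\partial\mathbb D$, and let $\rho(z,w)=\log\frac{|1-z\bar w|+|z-w|}{|1-z\bar w|-|z-w|}$ be the hyperbolic metric of $\mathbb D$. For $z\in\mathbb D$ and $\xi\in\partial\mathbb D$ let $P(z,\xi)=\frac{1-|z|^2}{|\xi-z|^2}$ be the Poisson kernel and $\mathfrak h(z,\xi)=\lim_{w\to\xi}\bigl(\rho(w,z)-\rho(w,0)\bigr)=-\log P(z,\xi)$ the Busemann function. For $\lambda\in\mathbb C$ put $s(\lambda)=\sqrt{\lambda+\tfrac14}$ (principal branch, argument in $(-\pi,\pi]$), and for $n\in\mathbb N_0$ put $$P_n(z,\xi\,|\,\lambda)=\frac{1}{n!\,(2s(\lambda))^n}\bigl(-\mathfrak h(z,\xi)\bigr)^nP(z,\xi)^{s(\lambda)+1/2}\quad(\lambda\ne-\tfrac14),\qquad P_n(z,\xi\,|-\tfrac14)=\frac{1}{(2n)!}\,\mathfrak h(z,\xi)^{2n}P(z,\xi)^{1/2},$$ $$\Phi_n(z\,|\,\lambda)=\int_{\partial\mathbb D}P_n(z,\xi\,|\,\lambda)\,d\ell(\xi),\qquad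 \mathcal P_{n,\lambda}\nu(z)=\int_{\partial\mathbb D}P_n(z,\xi\,|\,\lambda)\,d\nu(\xi),$$ where $\nu$ is a complex Borel measure on $\partial\mathbb D$. For $a\ge0$ and $\zeta\in\partial\mathbb D$, with $[0,\zeta]$ the line segment from $0$ to $\zeta$, let $$\Gamma_a(\zeta)=\{z\in\mathbb D:\rho(z,[0,\zeta])\le a\},\qquad \Gamma_{(a)}(\zeta)=\{z\in\mathbb D:\rho(z,[0,\zeta])\le a+\log\rho(z,0)\}.$$ A function $f$ converges admissibly (resp. enlarged-admissibly) at $\zeta$ to $L\in\mathbb C$ if, for every $a\ge0$, $f(z)\to L$ as $z\to\zeta$ within $\Gamma_a(\zeta)$ (resp. $\Gamma_{(a)}(\zeta)$). **Theorem.** Let $n\in\mathbb N_0$, let $\lambda\in\mathbb C\setminus(-\infty,-\tfrac14)$, and let $\nu$ be a complex Borel measure on $\partial\mathbb D$ (for example a finite positive one). Then there is $r_{n,\lambda}\in[0,1)$, with $r_{0,\lambda}=0$, such that $\Phi_n(z\,|\,\lambda)\ne0$ whenever $r_{n,\lambda}\le|z|<1$, and for $\ell$-almost every $\zeta\in\partial\mathbb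 D$ the normalised function $$\frac{\mathcal P_{n,\lambda}\nu(z)}{\Phi_n(z\,|\,\lambda)}\qquad(r_{n,\lambda}\le|z|<1)$$ converges admissibly at $\zeta$, with limit $\frac{d\nu^{\mathrm{ac}}}{d\ell}(\zeta)$, where $\nu^{\mathrm{ac}}$ is the absolutely continuous part of $\nu$ with respect to $\ell$. If $\lambda=-\tfrac14$, then for $\ell$-almost every $\zeta\in\partial\mathbb D$ the convergence is even enlarged-admissible, with the same limit. -/

import Mathlib

open MeasureTheory Filter Topology

namespace HypDisk

noncomputable section

/-- The unit circle carries its Borel σ-algebra. -/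
instance circleMeasurableSpace : MeasurableSpace Circle := borel Circle

instance circleBorelSpace : BorelSpace Circle := ⟨rfl⟩

/-- Normalised arc length on the unit circle: the image of `dφ / 2π` on `(-π, π]` under
`φ ↦ exp (i φ)`. -/
def arcLength : Measure Circle :=
  ENNReal.ofReal (2 * Real.pi)⁻¹ •
    (volume.restrict (Set.Ioc (-Real.pi) Real.pi)).map (fun φ : ℝ => Circle.exp φ)

/-- The hyperbolic distance of two points of the open unit disk. -/
def hypDist (z w : ℂ) : ℝ :=
  Real.log ((‖1 - z * starRingEnd ℂ w‖ + ‖z - w‖) / (‖1 - z * starRingEnd ℂ w‖ - ‖z - w‖))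

/-- The Poisson kernel of the unit disk. -/
def diskPoisson (z : ℂ) (ξ : Circle) : ℝ := poissonKernel 0 z (ξ : ℂ)

theorem diskPoisson_eq (z : ℂ) (ξ : Circle) :
    diskPoisson z ξ = (1 - ‖z‖ ^ 2) / ‖(ξ : ℂ) - z‖ ^ 2 := by
  have h := Circle.norm_coe ξ
  simp [diskPoisson, poissonKernel, h]

/-- The Busemann function; see `tendsto_hypDist_sub_busemann`. -/
def busemann (z : ℂ) (ξ : Circle) : ℝ :=
  -Real.log (diskPoisson z ξ)

/-- `s(lam) = √(lam + 1/4)`, principal branch, with `arg` in `(-π, π]`. -/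
def sOf (lam : ℂ) : ℂ := (lam + 1 / 4) ^ (1 / 2 : ℂ)

open Classical in
/-- The polyharmonic Poisson kernel `P_n(z, ξ | lam)`. -/
def polyKernel (n : ℕ) (lam : ℂ) (z : ℂ) (ξ : Circle) : ℂ :=
  if lam = -1 / 4 then
    1 / ((2 * n).factorial : ℂ) * (busemann z ξ : ℂ) ^ (2 * n)
      * (diskPoisson z ξ : ℂ) ^ (1 / 2 : ℂ)
  else
    1 / ((n.factorial : ℂ) * (2 * sOf lam) ^ n) * (-(busemann z ξ : ℂ)) ^ n
      * (diskPoisson z ξ : ℂ) ^ (sOf lam + 1 / 2)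

/-- The polyspherical function `Φ_n(z | lam)`. -/
def polyspherical (n : ℕ) (lam : ℂ) (z : ℂ) : ℂ :=
  ∫ ξ, polyKernel n lam z ξ ∂arcLength

/-- The generalised Poisson transform of a complex Borel measure: the integral of
`P_n(z, ξ | lam)` with respect to `ν`, the pairing being the multiplication of `ℂ`. -/
def polyPoisson (n : ℕ) (lam : ℂ) (ν : ComplexMeasure Circle) (z : ℂ) : ℂ :=
  ν.integral (fun ξ => polyKernel n lam z ξ) (ContinuousLinearMap.mul ℝ ℂ)

/-- The hyperbolic distance from `z` to the segment `[0, ζ]`. The end point `ζ`, which is at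
infinite distance, does not contribute. -/
def hypDistSegment (z : ℂ) (ζ : Circle) : ℝ :=
  ⨅ t : Set.Ico (0 : ℝ) 1, hypDist z ((t : ℝ) * (ζ : ℂ))

/-- The admissible region `Γ_a(ζ)`. -/
def admissibleRegion (a : ℝ) (ζ : Circle) : Set ℂ :=
  {z | ‖z‖ < 1 ∧ hypDistSegment z ζ ≤ a}

/-- The enlarged admissible region `Γ_(a)(ζ)`; the origin is not in it since `log 0 = -∞`. -/
def enlargedRegion (a : ℝ) (ζ : Circle) : Set ℂ :=
  {z | ‖z‖ < 1 ∧ z ≠ 0 ∧ hypDistSegment z ζ ≤ a + Real.log (hypDist z 0)}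

/-- `f` converges admissibly at `ζ`, with limit `L`. -/
def ConvergesAdmissibly (f : ℂ → ℂ) (ζ : Circle) (L : ℂ) : Prop :=
  ∀ a : ℝ, 0 ≤ a → Tendsto f (𝓝[admissibleRegion a ζ] (ζ : ℂ)) (𝓝 L)

/-- `f` converges enlarged-admissibly at `ζ`, with limit `L`. -/
def ConvergesEnlargedAdmissibly (f : ℂ → ℂ) (ζ : Circle) (L : ℂ) : Prop :=
  ∀ a : ℝ, 0 ≤ a → Tendsto f (𝓝[enlargedRegion a ζ] (ζ : ℂ)) (𝓝 L)

/-- The expression used to define `busemann` is the usual limit of differences of distances. -/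
theorem tendsto_hypDist_sub_busemann (z : ℂ) (hz : ‖z‖ < 1) (ξ : Circle) :
    Tendsto (fun w => hypDist w z - hypDist w 0) (𝓝[Metric.ball 0 1] (ξ : ℂ))
      (𝓝 (busemann z ξ)) := by
  have key : ∀ w u : ℂ, ‖1 - w * starRingEnd ℂ u‖ ^ 2 - ‖w - u‖ ^ 2
      = (1 - ‖w‖ ^ 2) * (1 - ‖u‖ ^ 2) := by
    intro w u
    simp only [← Complex.normSq_eq_norm_sq, Complex.normSq_apply, Complex.sub_re, Complex.sub_im,
      Complex.mul_re, Complex.mul_im, Complex.conj_re, Complex.conj_im, Complex.one_re,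
      Complex.one_im]
    ring
  have form : ∀ w u : ℂ, ‖w‖ < 1 → ‖u‖ < 1 → hypDist w u
      = 2 * Real.log (‖1 - w * starRingEnd ℂ u‖ + ‖w - u‖)
        - Real.log (1 - ‖w‖ ^ 2) - Real.log (1 - ‖u‖ ^ 2) := by
    intro w u hw hu
    have h1 : 0 < 1 - ‖w‖ ^ 2 := by nlinarith [norm_nonneg w]
    have h2 : 0 < 1 - ‖u‖ ^ 2 := by nlinarith [norm_nonneg u]
    have h3 := key w u
    have h4 := mul_pos h1 h2
    set A := ‖1 - w * starRingEnd ℂ u‖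
    set B := ‖w - u‖
    have hA : 0 ≤ A := norm_nonneg _
    have hB : 0 ≤ B := norm_nonneg _
    have hlt : 0 < A - B := by nlinarith
    have hs : 0 < A + B := by linarith
    have h5 : Real.log (A + B) + Real.log (A - B)
        = Real.log (1 - ‖w‖ ^ 2) + Real.log (1 - ‖u‖ ^ 2) := by
      rw [← Real.log_mul hs.ne' hlt.ne', ← Real.log_mul h1.ne' h2.ne', ← h3]
      congr 1
      ring
    unfold hypDist
    rw [Real.log_div hs.ne' hlt.ne']
    linarith
  have hzpos : 0 < 1 - ‖z‖ ^ 2 := by nlinarith [norm_nonneg z]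
  have hne : 0 < ‖(ξ : ℂ) - z‖ := by
    rw [norm_pos_iff, sub_ne_zero]
    intro h
    rw [← h, Circle.norm_coe] at hz
    exact lt_irrefl _ hz
  have hsame : ‖1 - (ξ : ℂ) * starRingEnd ℂ z‖ = ‖(ξ : ℂ) - z‖ := by
    have := key ξ z
    rw [Circle.norm_coe] at this
    have h : ‖1 - (ξ : ℂ) * starRingEnd ℂ z‖ ^ 2 = ‖(ξ : ℂ) - z‖ ^ 2 := by linarith
    exact (pow_left_inj₀ (norm_nonneg _) (norm_nonneg _) two_ne_zero).1 h
  have hval : busemann z ξ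
      = 2 * Real.log (‖1 - (ξ : ℂ) * starRingEnd ℂ z‖ + ‖(ξ : ℂ) - z‖)
        - Real.log (1 - ‖z‖ ^ 2) - 2 * Real.log (1 + ‖(ξ : ℂ)‖) := by
    unfold busemann
    rw [diskPoisson_eq, hsame, Circle.norm_coe, Real.log_div hzpos.ne' (by positivity), Real.log_pow,
      ← two_mul, Real.log_mul two_ne_zero hne.ne', one_add_one_eq_two]
    push_cast
    ring
  have hcont : Tendsto (fun w : ℂ => 2 * Real.log (‖1 - w * starRingEnd ℂ z‖ + ‖w - z‖)
        - Real.log (1 - ‖z‖ ^ 2) - 2 * Real.log (1 + ‖w‖)) (𝓝[Metric.ball 0 1] (ξ : ℂ))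
      (𝓝 (busemann z ξ)) := by
    rw [hval]
    refine Tendsto.mono_left (ContinuousAt.tendsto ?_) nhdsWithin_le_nhds
    have e1 : ‖1 - (ξ : ℂ) * starRingEnd ℂ z‖ + ‖(ξ : ℂ) - z‖ ≠ 0 := by positivity
    have e2 : 1 + ‖(ξ : ℂ)‖ ≠ 0 := by positivity
    refine ContinuousAt.sub (ContinuousAt.sub (ContinuousAt.mul continuousAt_const
      (ContinuousAt.log (by fun_prop) e1)) continuousAt_const)
      (ContinuousAt.mul continuousAt_const (ContinuousAt.log (by fun_prop) e2))
  refine hcont.congr' ?_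
  filter_upwards [self_mem_nhdsWithin] with w hw
  rw [mem_ball_zero_iff] at hw
  rw [form w z hw hz, form w 0 hw (by simp)]
  simp
  ring

end

end HypDisk

namespace HypDisk
noncomputable section

open scoped ENNReal NNReal Real

/-! This is a Fatou theorem, proved with radial majorants centred at the boundary point. At a
Lebesgue point `ζ` of `ν`, write `f` for its density and `ℓ` for arc length. Then `ν - f(ζ) ℓ` is
dominated by a finite positive measure `μ` with `μ(B(ζ,ε)) / ℓ(B(ζ,ε)) → 0`
(`ae_exists_dominating_measure`). If `|P_n(z,ξ)| ≤ |Φ_n(z)| k_z(|ξ - ζ|)`, where the `k_z` are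
decreasing with bounded integral and tend to `0` away from `0`, then integrating against `μ` shows
that the quotient tends to `f(ζ)` (`tendsto_integral_div_of_radial_majorant`).

Such majorants need three ingredients, with `δ = 1 - |z|` and `L = -log δ`. Geometry: admissible
approach means `|z - ζ| ≤ M δ`, and in the enlarged regions `M` grows like `L`. An upper bound on
the kernel: `|log P| ≤ 2L` and `P ≤ 2δ / |ξ - z|²`. A lower bound on `Φ_n`: of order `L^n δ^(1/2 -
Re s)` if `Re s > 0`, and `L^(2n+1) δ^(1/2)` if `λ = -1/4`. In the first case the kernel may
oscillate, so the lower bound comes from rescaling angles by `δ`; the limit is a multiple of `∫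
(2/(1+x²))^(s+1/2) dx`, which Gamma functions show to be nonzero. In the second case the integrand
is nonnegative, and integrating `1/φ` gives an extra logarithm. That surplus of `L` is what the
enlarged regions use up.

The lower bounds also show that `Φ_n` has no zeros near the circle. For `n = 0` there are none at
all: if `λ` is real the integrand is positive, and if `λ` is not real a zero would give a Dirichlet
eigenfunction of the Laplacian on a hyperbolic disk with nonreal eigenvalue (`radialInt_ne_zero`).
-/

/-! ### Arc length: rotation invariance, chordal balls, doubling. -/

theorem lintegral_arcLength {g : Circle → ℝ≥0∞} (hg : Measurable g) :
    ∫⁻ ξ, g ξ ∂arcLength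
      = ENNReal.ofReal (2 * π)⁻¹ * ∫⁻ φ in Set.Ioc (-π) π, g (Circle.exp φ) := by
  rw [arcLength, lintegral_smul_measure, lintegral_map hg Circle.exp.continuous.measurable,
    smul_eq_mul]

theorem integral_arcLength {E : Type*} [NormedAddCommGroup E] [NormedSpace ℝ E]
    [SecondCountableTopology E] {g : Circle → E} (hg : Continuous g) :
    ∫ ξ, g ξ ∂arcLength = (2 * π)⁻¹ • ∫ φ in (-π)..π, g (Circle.exp φ) := by
  borelize E
  rw [arcLength, integral_smul_measure, integral_map Circle.exp.continuous.measurable.aemeasurable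
    hg.measurable.aestronglyMeasurable, ENNReal.toReal_ofReal (by positivity),
    intervalIntegral.integral_of_le (by linarith [Real.pi_pos])]

instance : IsProbabilityMeasure arcLength := by
  constructor
  have h := lintegral_arcLength (g := fun _ => 1) measurable_const
  rw [lintegral_one] at h
  rw [h]
  simp only [lintegral_one, Measure.restrict_apply, MeasurableSet.univ, Set.univ_inter,
    Real.volume_Ioc]
  rw [← ENNReal.ofReal_mul (by positivity)]
  have := Real.pi_ne_zero
  rw [show (2 * π)⁻¹ * (π - -π) = 1 by field_simp; ring]
  simp

theorem lintegral_arcLength_eq_addCircle {g : Circle → ℝ≥0∞} (hg : Measurable g) :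
    haveI : Fact (0 < 2 * π) := ⟨Real.two_pi_pos⟩
    ∫⁻ ξ, g ξ ∂arcLength
      = ENNReal.ofReal (2 * π)⁻¹ * ∫⁻ b : AddCircle (2 * π), g (AddCircle.toCircle b) := by
  have : Fact (0 < 2 * π) := ⟨Real.two_pi_pos⟩
  rw [lintegral_arcLength hg,
    ← AddCircle.lintegral_preimage (2 * π) (-π) (fun b => g (AddCircle.toCircle b))]
  congr 2
  · rw [show -π + 2 * π = π by ring]
  · ext φ
    rw [AddCircle.toCircle_apply_mk, div_self Real.two_pi_pos.ne', one_mul]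

theorem lintegral_arcLength_mul_left {g : Circle → ℝ≥0∞} (hg : Measurable g) (u : Circle) :
    ∫⁻ ξ, g (u * ξ) ∂arcLength = ∫⁻ ξ, g ξ ∂arcLength := by
  have : Fact (0 < 2 * π) := ⟨Real.two_pi_pos⟩
  have hm : Measurable fun ξ : Circle => u * ξ := (continuous_const_mul u).measurable
  rw [lintegral_arcLength_eq_addCircle hg, lintegral_arcLength_eq_addCircle (g := fun ξ => g (u * ξ)) (hg.comp hm)]
  obtain ⟨α, rfl⟩ := Circle.exp_surjective u
  congr 1
  rw [← lintegral_add_left_eq_self (fun b : AddCircle (2 * π) => g b.toCircle) (α : AddCircle _)]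
  refine lintegral_congr fun b => ?_
  rw [AddCircle.toCircle_add, AddCircle.toCircle_apply_mk, div_self Real.two_pi_pos.ne', one_mul]

theorem map_mul_left_arcLength (u : Circle) :
    arcLength.map (fun ξ => u * ξ) = arcLength := by
  have hm : Measurable fun ξ : Circle => u * ξ := (continuous_const_mul u).measurable
  refine Measure.ext_of_lintegral _ fun g hg => ?_
  rw [lintegral_map hg hm, lintegral_arcLength_mul_left hg]

theorem integral_arcLength_mul_left {E : Type*} [NormedAddCommGroup E] [NormedSpace ℝ E]
    (g : Circle → E) (u : Circle) :
    ∫ ξ, g (u * ξ) ∂arcLength = ∫ ξ, g ξ ∂arcLength := by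
  conv_rhs => rw [← map_mul_left_arcLength u]
  exact ((Homeomorph.mulLeft u).measurableEmbedding.integral_map g).symm

theorem dist_circle_eq (x y : Circle) : dist x y = ‖(x : ℂ) - y‖ := by
  rw [← dist_eq_norm]
  rfl

theorem dist_exp_one (φ : ℝ) : dist (Circle.exp φ) 1 = 2 * |Real.sin (φ / 2)| := by
  rw [dist_circle_eq, Circle.coe_exp, Circle.coe_one]
  have h : Complex.exp (φ * Complex.I) - 1
      = 2 * Complex.I * Real.sin (φ / 2) * Complex.exp ((φ / 2 : ℝ) * Complex.I) := by
    apply Complex.ext <;>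
    simp [Complex.exp_ofReal_mul_I_re, Complex.exp_ofReal_mul_I_im, -Complex.ofReal_sin,
      -Complex.ofReal_div]
    · have := Real.cos_two_mul (φ / 2)
      have h2 := Real.sin_sq_add_cos_sq (φ / 2)
      rw [mul_div_cancel₀ _ two_ne_zero] at this
      rw [this]; linarith
    · have := Real.sin_two_mul (φ / 2)
      rw [mul_div_cancel₀ _ two_ne_zero] at this
      rw [this]
  rw [h, norm_mul, Complex.norm_exp_ofReal_mul_I, norm_mul, Complex.norm_real]
  simp

theorem dist_exp_one_le (φ : ℝ) : dist (Circle.exp φ) 1 ≤ |φ| := by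
  rw [dist_exp_one]
  have := Real.abs_sin_le_abs (x := φ / 2)
  rw [abs_div, abs_two] at this
  linarith

theorem le_dist_exp_one {φ : ℝ} (h : |φ| ≤ π) : 2 / π * |φ| ≤ dist (Circle.exp φ) 1 := by
  rw [dist_exp_one]
  have := Real.mul_abs_le_abs_sin (x := φ / 2) (by rw [abs_div, abs_two]; linarith)
  rw [abs_div, abs_two] at this
  linarith

theorem dist_mul_left_circle (u x y : Circle) : dist (u * x) (u * y) = dist x y := by
  simp only [dist_circle_eq, Circle.coe_mul]
  rw [← mul_sub, norm_mul, Circle.norm_coe, one_mul]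

theorem lintegral_radial_eq {k : ℝ → ℝ≥0∞} (hk : Measurable fun ξ : Circle => k (dist ξ 1))
    (ζ : Circle) :
    ∫⁻ ξ, k (dist ξ ζ) ∂arcLength
      = ENNReal.ofReal (2 * π)⁻¹ * ∫⁻ φ in Set.Ioc (-π) π, k (dist (Circle.exp φ) 1) := by
  rw [← lintegral_arcLength hk, ← lintegral_arcLength_mul_left hk ζ⁻¹]
  refine lintegral_congr fun ξ => ?_
  rw [← dist_mul_left_circle ζ⁻¹ ξ ζ, inv_mul_cancel]

theorem arcLength_closedBall_eq (ζ : Circle) (ε : ℝ) :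
    arcLength (Metric.closedBall ζ ε)
      = ENNReal.ofReal (2 * π)⁻¹
        * volume ({φ : ℝ | dist (Circle.exp φ) 1 ≤ ε} ∩ Set.Ioc (-π) π) := by
  have hm : MeasurableSet {φ : ℝ | dist (Circle.exp φ) 1 ≤ ε} :=
    (isClosed_le (by fun_prop) continuous_const).measurableSet
  have h := lintegral_radial_eq (k := Set.indicator (Set.Iic ε) 1)
    ((measurable_one.indicator measurableSet_Iic).comp (by fun_prop)) ζ
  have h1 : ∀ ξ, Set.indicator (Set.Iic ε) (1 : ℝ → ℝ≥0∞) (dist ξ ζ)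
      = Set.indicator (Metric.closedBall ζ ε) 1 ξ := fun ξ => by
    by_cases h : dist ξ ζ ≤ ε <;> simp [Set.indicator, h]
  have h2 : ∀ φ : ℝ, Set.indicator (Set.Iic ε) (1 : ℝ → ℝ≥0∞) (dist (Circle.exp φ) 1)
      = Set.indicator {φ : ℝ | dist (Circle.exp φ) 1 ≤ ε} 1 φ := fun φ => by
    by_cases h : dist (Circle.exp φ) 1 ≤ ε <;> simp [Set.indicator, h]
  simp only [h1, h2] at h
  rw [lintegral_indicator_one Metric.isClosed_closedBall.measurableSet,
    lintegral_indicator_one hm, Measure.restrict_apply hm] at h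
  exact h

/-- By Jordan's inequality a chord of length at most `ε` subtends an angle of at most `π ε / 2`.
Together with `le_arcLength_closedBall` this pins the measure of a ball between `ε / π` and `ε / 2`.
-/
theorem arcLength_closedBall_le (ζ : Circle) (ε : ℝ) :
    arcLength (Metric.closedBall ζ ε) ≤ ENNReal.ofReal (ε / 2) := by
  rw [arcLength_closedBall_eq]
  have hpi := Real.pi_pos
  have hsub : {φ : ℝ | dist (Circle.exp φ) 1 ≤ ε} ∩ Set.Ioc (-π) π
      ⊆ Set.Icc (-(π / 2 * ε)) (π / 2 * ε) := by
    rintro φ ⟨h1, h2⟩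
    have h3 := (le_dist_exp_one (abs_le.2 ⟨h2.1.le, h2.2⟩)).trans h1
    rw [Set.mem_Icc, ← abs_le]
    calc |φ| = π / 2 * (2 / π * |φ|) := by field_simp
      _ ≤ _ := by gcongr
  refine (mul_le_mul_right (measure_mono hsub) _).trans ?_
  rw [Real.volume_Icc, ← ENNReal.ofReal_mul (by positivity)]
  refine ENNReal.ofReal_le_ofReal (le_of_eq ?_)
  field_simp
  ring

theorem le_arcLength_closedBall (ζ : Circle) {ε : ℝ} (hε : ε < π) :
    ENNReal.ofReal (ε / π) ≤ arcLength (Metric.closedBall ζ ε) := by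
  rw [arcLength_closedBall_eq]
  have hpi := Real.pi_pos
  have hsub : Set.Icc (-ε) ε ⊆ {φ : ℝ | dist (Circle.exp φ) 1 ≤ ε} ∩ Set.Ioc (-π) π := by
    intro φ h
    exact ⟨(dist_exp_one_le φ).trans (abs_le.2 h), by linarith [h.1], by linarith [h.2]⟩
  refine le_trans (le_of_eq ?_) (mul_le_mul_right (measure_mono hsub) _)
  rw [Real.volume_Icc, ← ENNReal.ofReal_mul (by positivity)]
  congr 1
  field_simp
  ring

instance : IsUnifLocDoublingMeasure arcLength := by
  -- The ratio of the two ball estimates at radii `2ε` and `ε` is `ε / (ε / π) = π ≤ 4`.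
  refine ⟨4, ?_⟩
  filter_upwards [Ioo_mem_nhdsGT Real.pi_pos] with ε hε x
  refine (arcLength_closedBall_le x _).trans
    (le_trans ?_ (mul_le_mul_right (le_arcLength_closedBall x hε.2) _))
  rw [show ((4 : ℝ≥0) : ℝ≥0∞) = ENNReal.ofReal 4 by simp, ← ENNReal.ofReal_mul (by norm_num)]
  refine ENNReal.ofReal_le_ofReal ?_
  have := hε.1
  rw [mul_div_cancel_left₀ _ two_ne_zero, mul_div, le_div_iff₀ Real.pi_pos]
  nlinarith [Real.pi_le_four]

/-! ### Integration of decreasing radial kernels. -/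

/-- Layer-cake formula: inside the ball of radius `ε₀`, the superlevel sets of a decreasing radial
function are balls about `ζ`, on which the two measures can be compared. Outside, the kernel is at
most `k ε₀`. -/
theorem lintegral_radial_le {X : Type*} [PseudoMetricSpace X] [MeasurableSpace X]
    [OpensMeasurableSpace X] (μ κ : Measure X) (ζ : X) {k : ℝ → ℝ}
    (hk0 : ∀ t, 0 ≤ t → 0 ≤ k t) (hcont : ContinuousOn k (Set.Ici 0))
    (hanti : AntitoneOn k (Set.Ici 0)) {ε₀ : ℝ} (hε₀ : 0 ≤ ε₀) {η : ℝ≥0∞} (hη : η ≠ ∞)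
    (hball : ∀ ε, 0 ≤ ε → ε ≤ ε₀ →
      μ (Metric.closedBall ζ ε) ≤ η * κ (Metric.closedBall ζ ε)) :
    ∫⁻ ξ, ENNReal.ofReal (k (dist ξ ζ)) ∂μ
      ≤ η * ∫⁻ ξ, ENNReal.ofReal (k (dist ξ ζ)) ∂κ + ENNReal.ofReal (k ε₀) * μ Set.univ := by
  have hkc : Continuous fun ξ : X => k (dist ξ ζ) :=
    hcont.comp_continuous (by fun_prop) fun ξ => dist_nonneg
  have hB : MeasurableSet (Metric.closedBall ζ ε₀) := Metric.isClosed_closedBall.measurableSet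
  rw [← lintegral_add_compl _ hB]
  refine add_le_add ?_ ?_
  · refine le_trans ?_ (mul_le_mul_right (setLIntegral_le_lintegral (Metric.closedBall ζ ε₀) _) _)
    rw [lintegral_eq_lintegral_meas_le _ (Eventually.of_forall fun ξ => hk0 _ dist_nonneg)
        hkc.measurable.aemeasurable,
      lintegral_eq_lintegral_meas_le _ (Eventually.of_forall fun ξ => hk0 _ dist_nonneg)
        hkc.measurable.aemeasurable, ← lintegral_const_mul' _ _ hη]
    refine lintegral_mono fun s => ?_
    rw [Measure.restrict_apply (measurableSet_le measurable_const hkc.measurable),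
      Measure.restrict_apply (measurableSet_le measurable_const hkc.measurable)]
    set T : Set ℝ := Set.Icc 0 ε₀ ∩ k ⁻¹' Set.Ici s
    have hT : IsCompact T :=
      isCompact_Icc.of_isClosed_subset
        ((hcont.mono Set.Icc_subset_Ici_self).preimage_isClosed_of_isClosed isClosed_Icc
          isClosed_Ici) Set.inter_subset_left
    have hset : {a : X | s ≤ k (dist a ζ)} ∩ Metric.closedBall ζ ε₀ = {a | dist a ζ ∈ T} := by
      ext a
      simp only [T, Set.mem_inter_iff, Set.mem_ofPred_eq, Metric.mem_closedBall, Set.mem_Icc,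
        Set.mem_preimage, Set.mem_Ici, dist_nonneg, true_and]
      exact and_comm
    rw [hset]
    -- Continuity of `k` makes the set of admissible radii compact, so a nonempty superlevel set is
    -- a closed ball whose radius is the greatest element. This radius can be `0`, which is why
    -- `hball` includes that case.
    rcases T.eq_empty_or_nonempty with h | h
    · simp [h]
    · obtain ⟨τ, hτ, hmax⟩ := hT.exists_isGreatest h
      have : {a : X | dist a ζ ∈ T} = Metric.closedBall ζ τ := by
        ext a
        refine ⟨fun ha => hmax ha, fun ha => ⟨⟨dist_nonneg, le_trans ha hτ.1.2⟩, ?_⟩⟩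
        exact le_trans hτ.2 (hanti dist_nonneg hτ.1.1 ha)
      rw [this]
      exact hball τ hτ.1.1 hτ.1.2
  · refine (setLIntegral_mono (g := fun _ => ENNReal.ofReal (k ε₀)) measurable_const ?_).trans ?_
    · intro ξ hξ
      refine ENNReal.ofReal_le_ofReal (hanti hε₀ dist_nonneg ?_)
      simpa using! le_of_lt (by simpa using! hξ)
    · rw [setLIntegral_const]
      exact mul_le_mul_right (measure_mono (Set.subset_univ _)) _

/-- The chord at angle `φ` is at least `2|φ|/π`, so a decreasing kernel only grows when the chord is
replaced by this. The substitution `t = 2φ/π` on both half circles gives the factor `(2π)⁻¹ · 2 ·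
π/2 = 1/2`. -/
theorem lintegral_radial_arcLength_le (ζ : Circle) {k : ℝ → ℝ}
    (hk0 : ∀ t, 0 ≤ t → 0 ≤ k t) (hcont : ContinuousOn k (Set.Ici 0))
    (hanti : AntitoneOn k (Set.Ici 0)) :
    ∫⁻ ξ, ENNReal.ofReal (k (dist ξ ζ)) ∂arcLength
      ≤ ENNReal.ofReal (1 / 2 * ∫ t in (0 : ℝ)..2, k t) := by
  have hpi := Real.pi_pos
  have hkc : Continuous fun ξ : Circle => k (dist ξ 1) :=
    hcont.comp_continuous (by fun_prop) fun ξ => dist_nonneg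
  rw [lintegral_radial_eq (k := fun t => ENNReal.ofReal (k t)) hkc.measurable.ennreal_ofReal ζ]
  have hc : Continuous fun φ : ℝ => k (2 / π * |φ|) :=
    hcont.comp_continuous (by fun_prop) fun φ => by simp only [Set.mem_Ici]; positivity
  have h1 : ∫⁻ φ in Set.Ioc (-π) π, ENNReal.ofReal (k (dist (Circle.exp φ) 1))
      ≤ ∫⁻ φ in Set.Ioc (-π) π, ENNReal.ofReal (k (2 / π * |φ|)) := by
    refine setLIntegral_mono hc.measurable.ennreal_ofReal fun φ hφ => ENNReal.ofReal_le_ofReal ?_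
    exact hanti (by simp only [Set.mem_Ici]; positivity) dist_nonneg
      (le_dist_exp_one (abs_le.2 ⟨hφ.1.le, hφ.2⟩))
  refine (mul_le_mul_right h1 _).trans ?_
  rw [← ofReal_integral_eq_lintegral_ofReal
    ((hc.integrableOn_Icc (a := -π) (b := π)).mono_set Set.Ioc_subset_Icc_self)
    (Eventually.of_forall fun φ => hk0 _ (by positivity)),
    ← intervalIntegral.integral_of_le (by linarith), ← ENNReal.ofReal_mul (by positivity)]
  refine ENNReal.ofReal_le_ofReal (le_of_eq ?_)
  rw [← intervalIntegral.integral_add_adjacent_intervals (hc.intervalIntegrable (-π) 0)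
    (hc.intervalIntegrable 0 π)]
  have h2 : ∫ φ in (0 : ℝ)..π, k (2 / π * |φ|) = π / 2 * ∫ t in (0 : ℝ)..2, k t := by
    rw [intervalIntegral.integral_congr (g := fun φ => k (2 / π * φ))]
    · rw [intervalIntegral.integral_comp_mul_left _ (by positivity)]
      rw [mul_zero, div_mul_cancel₀ _ hpi.ne', inv_div, smul_eq_mul]
    · intro φ hφ
      rw [Set.uIcc_of_le hpi.le] at hφ
      simp only [abs_of_nonneg hφ.1]
  have h3 : ∫ φ in (-π)..0, k (2 / π * |φ|) = ∫ φ in (0 : ℝ)..π, k (2 / π * |φ|) := by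
    have := intervalIntegral.integral_comp_neg (a := 0) (b := π) fun φ => k (2 / π * |φ|)
    simp only [abs_neg, neg_zero] at this
    exact this.symm
  rw [h3, h2]
  field_simp
  ring

/-! ### Lebesgue points of a complex measure and the abstract Fatou theorem. -/

/-- The variation of `c μ` is `‖c‖ μ`, so the integral against the vector measure extends
continuously to `L¹(μ)`. It then suffices to compare the two sides on indicators. -/
theorem integral_withDensityᵥ_const {X : Type*} [MeasurableSpace X] (μ : Measure X)
    [IsFiniteMeasure μ] (c : ℂ) {g : X → ℂ} (hg : Integrable g μ) :
    (μ.withDensityᵥ fun _ => c).integral g (ContinuousLinearMap.mul ℝ ℂ) = c * ∫ x, g x ∂μ := by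
  set W := μ.withDensityᵥ fun _ => c
  have hvar : W.variation = ‖c‖ₑ • μ := by
    rw [Measure.variation_withDensityᵥ (integrable_const c), withDensity_const]
  have hT := dominatedFinMeasAdditive_cbmApplyMeasure W (ContinuousLinearMap.mul ℝ ℂ)
  have hT' : DominatedFinMeasAdditive μ (W.transpose (ContinuousLinearMap.mul ℝ ℂ)) _ :=
    DominatedFinMeasAdditive.of_measure_le_smul enorm_ne_top hvar.le hT (ContinuousLinearMap.opNorm_nonneg _)
  have hW : W.integral g (ContinuousLinearMap.mul ℝ ℂ)
      = setToFun μ (W.transpose (ContinuousLinearMap.mul ℝ ℂ)) hT' g :=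
    (setToFun_congr_measure_of_integrable ‖c‖ₑ enorm_ne_top hvar.le hT' hT g hg).symm
  rw [hW]
  refine Integrable.induction
    (fun f => setToFun μ (W.transpose (ContinuousLinearMap.mul ℝ ℂ)) hT' f = c * ∫ x, f x ∂μ)
    ?_ ?_ ?_ ?_ hg
  · intro a s hs hμs
    rw [setToFun_indicator_const hT' hs hμs.ne, integral_indicator_const a hs]
    simp only [transpose_eq_cbmApplyMeasure, cbmApplyMeasure_apply]
    simp only [W, ContinuousLinearMap.mul_apply', withDensityᵥ_apply (integrable_const c) hs,
      setIntegral_const]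
    simp only [Complex.real_smul]
    ring
  · intro f g _ hf hg h1 h2
    rw [setToFun_add hT' hf hg, h1, h2, ← mul_add, ← integral_add hf hg]
    rfl
  · exact isClosed_eq (continuous_setToFun hT') (continuous_const.mul continuous_integral)
  · intro f g hfg _ h
    rw [← setToFun_congr_ae hT' hfg, h, integral_congr_ae hfg]

/-- The total variations of the real and imaginary singular parts are both singular to `μ`, and
their sum dominates the complex variation. -/
theorem exists_mutuallySingular_variation_singularPart_le {X : Type*} [MeasurableSpace X]
    (ν : ComplexMeasure X) (μ : Measure X) :
    ∃ τ : Measure X, IsFiniteMeasure τ ∧ τ ⟂ₘ μ ∧ (ν.singularPart μ).variation ≤ τ := by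
  refine ⟨(ν.re.singularPart μ).totalVariation + (ν.im.singularPart μ).totalVariation, ?_, ?_, ?_⟩
  · infer_instance
  · simp only [SignedMeasure.singularPart_totalVariation, Measure.MutuallySingular.add_left_iff]
    exact ⟨⟨Measure.mutuallySingular_singularPart _ _, Measure.mutuallySingular_singularPart _ _⟩,
      Measure.mutuallySingular_singularPart _ _, Measure.mutuallySingular_singularPart _ _⟩
  · refine VectorMeasure.variation_le_of_forall_enorm_le fun E _ => ?_
    have h : (ν.singularPart μ) E
        = ((ν.re.singularPart μ E : ℝ) : ℂ) + (ν.im.singularPart μ E : ℝ) * Complex.I := by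
      rw [ComplexMeasure.singularPart, SignedMeasure.toComplexMeasure_apply]
      apply Complex.ext <;> simp
    rw [h]
    refine (enorm_add_le _ _).trans ?_
    rw [Measure.add_apply]
    refine add_le_add ?_ ?_
    · refine le_trans (le_of_eq ?_) ((ν.re.singularPart μ).enorm_le_totalVariation E)
      simp [enorm_eq_nnnorm]
    · refine le_trans (le_of_eq ?_) ((ν.im.singularPart μ).enorm_le_totalVariation E)
      simp [enorm_eq_nnnorm]

/-- Lebesgue points: at almost every `ζ`, the measure `ν - (dν/dℓ)(ζ) ℓ` is dominated by a finite
positive measure whose density at `ζ` vanishes. -/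
theorem ae_exists_dominating_measure (ν : ComplexMeasure Circle) :
    ∀ᵐ ζ ∂arcLength, ∃ μ : Measure Circle, IsFiniteMeasure μ ∧
      Tendsto (fun ε => μ (Metric.closedBall ζ ε) / arcLength (Metric.closedBall ζ ε))
        (𝓝[>] 0) (𝓝 0) ∧
      ∀ g : Circle → ℂ, Continuous g →
        ‖ν.integral g (ContinuousLinearMap.mul ℝ ℂ)
          - ν.rnDeriv arcLength ζ * ∫ ξ, g ξ ∂arcLength‖ₑ ≤ ∫⁻ ξ, ‖g ξ‖ₑ ∂μ := by
  obtain ⟨τ, hτf, hτ, hle⟩ := exists_mutuallySingular_variation_singularPart_le ν arcLength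
  set f := ν.rnDeriv arcLength
  have hf : Integrable f arcLength := ν.integrable_rnDeriv arcLength
  set v := IsUnifLocDoublingMeasure.vitaliFamily arcLength 1
  filter_upwards [v.ae_eventually_measure_zero_of_singular hτ,
    v.ae_tendsto_lintegral_enorm_sub_div hf.locallyIntegrable] with ζ h1 h2
  have hlim : Tendsto (fun ε => Metric.closedBall ζ ε) (𝓝[>] 0) (v.filterAt ζ) := by
    refine IsUnifLocDoublingMeasure.tendsto_closedBall_filterAt arcLength (fun _ => ζ) (fun ε => ε)
      tendsto_id ?_
    filter_upwards [self_mem_nhdsWithin] with ε hε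
    exact Metric.mem_closedBall_self (by simpa using! le_of_lt hε)
  have hsub : Integrable (fun ξ => f ξ - f ζ) arcLength := hf.sub (integrable_const _)
  have hfin : IsFiniteMeasure (arcLength.withDensity fun ξ => ‖f ξ - f ζ‖ₑ) :=
    isFiniteMeasure_withDensity hsub.2.ne
  -- The singular part has density `0` at almost every point, and `|f - f(ζ)| ℓ` has density `0` at
  -- a Lebesgue point of `f`.
  refine ⟨τ + arcLength.withDensity fun ξ => ‖f ξ - f ζ‖ₑ, inferInstance, ?_, ?_⟩
  · have := (h1.comp hlim).add (h2.comp hlim)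
    rw [add_zero] at this
    refine this.congr fun ε => ?_
    simp only [Function.comp, Measure.add_apply]
    rw [withDensity_apply _ Metric.isClosed_closedBall.measurableSet, ENNReal.add_div]
  · intro g hg
    have hfinS : IsFiniteMeasure (ν.singularPart arcLength).variation := isFiniteMeasure_of_le _ hle
    have hint : ∀ (μ : Measure Circle) [IsFiniteMeasure μ], Integrable g μ := fun μ _ =>
      hg.integrable_of_hasCompactSupport (HasCompactSupport.of_compactSpace g)
    have hv1 : (arcLength.withDensityᵥ fun ξ => f ξ - f ζ).variation
        = arcLength.withDensity fun ξ => ‖f ξ - f ζ‖ₑ := Measure.variation_withDensityᵥ hsub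
    have hv2 : (arcLength.withDensityᵥ fun _ : Circle => f ζ).variation
        = ‖f ζ‖ₑ • arcLength := by
      rw [Measure.variation_withDensityᵥ (integrable_const _), withDensity_const]
    have hdec : ν = (ν.singularPart arcLength + arcLength.withDensityᵥ fun ξ => f ξ - f ζ)
        + arcLength.withDensityᵥ fun _ => f ζ := by
      rw [add_assoc, ← withDensityᵥ_add' hsub (integrable_const _)]
      simp only [sub_add_cancel]
      have : ν.HaveLebesgueDecomposition arcLength := ⟨inferInstance, inferInstance⟩
      exact ν.singularPart_add_withDensity_rnDeriv_eq.symm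
    have hvar : (ν.singularPart arcLength
        + arcLength.withDensityᵥ fun ξ => f ξ - f ζ).variation
        ≤ τ + arcLength.withDensity fun ξ => ‖f ξ - f ζ‖ₑ :=
      VectorMeasure.variation_add_le.trans (add_le_add hle hv1.le)
    have hfinA : IsFiniteMeasure (ν.singularPart arcLength
        + arcLength.withDensityᵥ fun ξ => f ξ - f ζ).variation := isFiniteMeasure_of_le _ hvar
    have hI2 : (arcLength.withDensityᵥ fun _ : Circle => f ζ).Integrable g := by
      rw [VectorMeasure.Integrable, hv2]
      exact (hint arcLength).smul_measure enorm_ne_top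
    conv_lhs => rw [hdec]
    rw [VectorMeasure.integral_add_vectorMeasure (hint _) hI2,
      integral_withDensityᵥ_const _ _ (hint _), add_sub_cancel_right]
    refine VectorMeasure.enorm_integral_le_lintegral_enorm.trans ?_
    have hm : ‖ContinuousLinearMap.mul ℝ ℂ‖ₑ = 1 := by
      rw [← ofReal_norm, ContinuousLinearMap.opNorm_mul, ENNReal.ofReal_one]
    rw [hm, one_mul]
    exact lintegral_mono' hvar le_rfl

/-- Kernels with an integrable radial majorant that concentrates at `ζ` recover the density of a
measure at `ζ`. -/
theorem tendsto_integral_div_of_radial_majorant {F : Filter ℂ} {ν : ComplexMeasure Circle}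
    {ζ : Circle} {c : ℂ} {μ : Measure Circle} [IsFiniteMeasure μ]
    (hμ : Tendsto (fun ε => μ (Metric.closedBall ζ ε) / arcLength (Metric.closedBall ζ ε))
      (𝓝[>] 0) (𝓝 0))
    (hν : ∀ g : Circle → ℂ, Continuous g →
      ‖ν.integral g (ContinuousLinearMap.mul ℝ ℂ) - c * ∫ ξ, g ξ ∂arcLength‖ₑ ≤ ∫⁻ ξ, ‖g ξ‖ₑ ∂μ)
    {N : ℂ → Circle → ℂ} {k : ℂ → ℝ → ℝ} {A : ℝ}
    (hN : ∀ᶠ z in F, Continuous (N z)) (hD : ∀ᶠ z in F, ∫ ξ, N z ξ ∂arcLength ≠ 0)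
    (hk0 : ∀ᶠ z in F, ∀ t, 0 ≤ t → 0 ≤ k z t)
    (hcont : ∀ᶠ z in F, ContinuousOn (k z) (Set.Ici 0))
    (hanti : ∀ᶠ z in F, AntitoneOn (k z) (Set.Ici 0))
    (hle : ∀ᶠ z in F, ∀ ξ, ‖N z ξ‖ ≤ ‖∫ ξ, N z ξ ∂arcLength‖ * k z (dist ξ ζ))
    (hA : ∀ᶠ z in F, ∫ t in (0 : ℝ)..2, k z t ≤ A)
    (hlim : ∀ ε, 0 < ε → Tendsto (fun z => k z ε) F (𝓝 0)) :
    Tendsto (fun z => ν.integral (N z) (ContinuousLinearMap.mul ℝ ℂ) / ∫ ξ, N z ξ ∂arcLength)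
      F (𝓝 c) := by
  rw [Metric.tendsto_nhds]
  intro e he
  -- The near part of the majorant has `μ`-integral at most `η · A/2`; this choice of `η` keeps it
  -- below `e/2`. The far part, `k z ε₀` times the mass of `μ`, supplies the other half.
  set η : ℝ := e / (|A| + 1)
  have hη : 0 < η := by positivity
  have hηA : η * (1 / 2 * A) ≤ e / 2 := by
    have h1 : η * (|A| + 1) = e := div_mul_cancel₀ _ (by positivity)
    nlinarith [le_abs_self A]
  obtain ⟨ε₁, hε₁, hball₁⟩ : ∃ ε₁ > 0, ∀ ε ∈ Set.Ioo 0 ε₁,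
      μ (Metric.closedBall ζ ε) / arcLength (Metric.closedBall ζ ε) < ENNReal.ofReal η := by
    have := hμ.eventually (gt_mem_nhds (ENNReal.ofReal_pos.2 hη))
    obtain ⟨ε₁, hε₁, h⟩ := mem_nhdsGT_iff_exists_Ioo_subset.1 this
    exact ⟨ε₁, hε₁, fun ε hε => h hε⟩
  have hball₂ : ∀ ε, 0 < ε → ε < min ε₁ 1 →
      μ (Metric.closedBall ζ ε) ≤ ENNReal.ofReal η * arcLength (Metric.closedBall ζ ε) := by
    intro ε h0 h1
    have hpos : 0 < arcLength (Metric.closedBall ζ ε) :=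
      lt_of_lt_of_le (ENNReal.ofReal_pos.2 (by positivity)) (le_arcLength_closedBall ζ
        (lt_trans (lt_of_lt_of_le h1 (min_le_right _ _)) (by linarith [Real.pi_gt_three])))
    exact (ENNReal.div_le_iff hpos.ne' (measure_ne_top _ _)).1
      (hball₁ ε ⟨h0, lt_of_lt_of_le h1 (min_le_left _ _)⟩).le
  -- Vanishing density rules out an atom of `μ` at `ζ`; this is the radius-zero case needed by
  -- `lintegral_radial_le`.
  have hzero : μ (Metric.closedBall ζ 0) ≤ 0 := by
    have hlim0 : Tendsto (fun ε : ℝ => ENNReal.ofReal η * ENNReal.ofReal (ε / 2))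
        (𝓝[>] 0) (𝓝 0) := by
      have hc : Continuous fun ε : ℝ => ENNReal.ofReal (η * (ε / 2)) :=
        ENNReal.continuous_ofReal.comp (by fun_prop)
      have := hc.tendsto 0
      rw [zero_div, mul_zero, ENNReal.ofReal_zero] at this
      refine (this.mono_left nhdsWithin_le_nhds).congr fun ε => ?_
      rw [ENNReal.ofReal_mul hη.le]
    refine ge_of_tendsto hlim0 ?_
    filter_upwards [Ioo_mem_nhdsGT (lt_min hε₁ one_pos)] with ε hε
    exact (measure_mono (Metric.closedBall_subset_closedBall hε.1.le)).trans
      ((hball₂ ε hε.1 hε.2).trans (mul_le_mul_right (arcLength_closedBall_le ζ ε) _))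
  set ε₀ : ℝ := min ε₁ 1 / 2
  have hε₀ : 0 < ε₀ := by positivity
  have hball : ∀ ε, 0 ≤ ε → ε ≤ ε₀ →
      μ (Metric.closedBall ζ ε) ≤ ENNReal.ofReal η * arcLength (Metric.closedBall ζ ε) := by
    intro ε h0 h1
    rcases h0.eq_or_lt with rfl | h0
    · exact hzero.trans zero_le
    · exact hball₂ ε h0 (lt_of_le_of_lt h1 (half_lt_self (by positivity)))
  have hsmall : ∀ᶠ z in F, k z ε₀ * μ.real Set.univ < e / 2 := by
    have := (hlim ε₀ hε₀).mul_const (μ.real Set.univ)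
    rw [zero_mul] at this
    exact this.eventually (gt_mem_nhds (half_pos he))
  filter_upwards [hN, hD, hk0, hcont, hanti, hle, hA, hsmall] with z hN hD hk0 hcont hanti hle hA hs
  set D := ∫ ξ, N z ξ ∂arcLength
  have h1 : ∫⁻ ξ, ‖N z ξ‖ₑ ∂μ ≤ ‖D‖ₑ * ∫⁻ ξ, ENNReal.ofReal (k z (dist ξ ζ)) ∂μ := by
    rw [← lintegral_const_mul' _ _ enorm_ne_top]
    refine lintegral_mono fun ξ => ?_
    rw [← ofReal_norm, ← ofReal_norm, ← ENNReal.ofReal_mul (norm_nonneg _)]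
    exact ENNReal.ofReal_le_ofReal (hle ξ)
  have h2 : ∫⁻ ξ, ENNReal.ofReal (k z (dist ξ ζ)) ∂μ
      ≤ ENNReal.ofReal (e / 2 + k z ε₀ * μ.real Set.univ) := by
    refine (lintegral_radial_le μ arcLength ζ hk0 hcont hanti hε₀.le ENNReal.ofReal_ne_top
      hball).trans ?_
    rw [ENNReal.ofReal_add (half_pos he).le (mul_nonneg (hk0 _ hε₀.le) measureReal_nonneg)]
    refine add_le_add ?_ ?_
    · refine (mul_le_mul_right (lintegral_radial_arcLength_le ζ hk0 hcont hanti) _).trans ?_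
      rw [← ENNReal.ofReal_mul hη.le]
      refine ENNReal.ofReal_le_ofReal (le_trans ?_ hηA)
      gcongr
    · rw [ENNReal.ofReal_mul (hk0 _ hε₀.le), ofReal_measureReal]
  have h3 := (hν (N z) hN).trans (h1.trans (mul_le_mul_right h2 _))
  rw [← ofReal_norm, ← ofReal_norm, ← ENNReal.ofReal_mul (norm_nonneg _),
    ENNReal.ofReal_le_ofReal_iff (mul_nonneg (norm_nonneg _)
      (add_nonneg (half_pos he).le (mul_nonneg (hk0 _ hε₀.le) measureReal_nonneg)))] at h3
  have hDn : 0 < ‖D‖ := norm_pos_iff.2 hD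
  rw [dist_eq_norm, div_sub' hD, norm_div, div_lt_iff₀ hDn, mul_comm D c]
  refine h3.trans_lt ?_
  rw [mul_comm]
  gcongr
  linarith

/-! ### Euclidean shape of the admissible regions. -/

theorem norm_one_sub_mul_conj_sq (w u : ℂ) :
    ‖1 - w * starRingEnd ℂ u‖ ^ 2 - ‖w - u‖ ^ 2 = (1 - ‖w‖ ^ 2) * (1 - ‖u‖ ^ 2) := by
  simp only [← Complex.normSq_eq_norm_sq, Complex.normSq_apply, Complex.sub_re, Complex.sub_im,
    Complex.mul_re, Complex.mul_im, Complex.conj_re, Complex.conj_im, Complex.one_re,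
    Complex.one_im]
  ring

/-- With `D = |1 - z conj(tζ)| = |ζ - tz|`, `d = |z - tζ|` and `A = exp ρ = (D+d)/(D-d)`, one has
`D² ≤ (D+d)² = A(D² - d²) ≤ 4A(1-|z|)(1-t)`. Since `D ≥ 1 - t`, both `1 - t` and `D` are at most
`4A(1-|z|)`, and `|z - ζ| ≤ D + (1-t)|z|`. -/
theorem norm_sub_le_of_hypDist {z : ℂ} (hz : ‖z‖ < 1) (ζ : Circle) {t : ℝ} (ht0 : 0 ≤ t)
    (ht1 : t < 1) :
    ‖z - ζ‖ ≤ 8 * Real.exp (hypDist z (t * ζ)) * (1 - ‖z‖) := by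
  have hu : ‖((t : ℝ) * ζ : ℂ)‖ = t := by
    rw [norm_mul, Circle.norm_coe, Complex.norm_real, mul_one, Real.norm_of_nonneg ht0]
  have key := norm_one_sub_mul_conj_sq z (t * ζ)
  rw [hu] at key
  have hDeq : ‖1 - z * starRingEnd ℂ (t * ζ)‖ = ‖(ζ : ℂ) - t * z‖ := by
    rw [← one_mul ‖1 - _‖, ← Circle.norm_coe ζ, ← norm_mul]
    congr 1
    have : (ζ : ℂ) * starRingEnd ℂ ζ = 1 := by rw [Complex.mul_conj]; simp
    rw [map_mul, Complex.conj_ofReal]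
    linear_combination (-z * t) * this
  set D := ‖1 - z * starRingEnd ℂ (t * ζ)‖
  set d := ‖z - t * ζ‖
  have hd : 0 ≤ d := norm_nonneg _
  have hz0 := norm_nonneg z
  have hδ : 0 < 1 - ‖z‖ := by linarith
  have hprod : 0 < (1 - ‖z‖ ^ 2) * (1 - t ^ 2) := mul_pos (by nlinarith) (by nlinarith)
  have hD0 : 0 ≤ D := norm_nonneg _
  have hlt : 0 < D - d := by nlinarith
  have hsum : 0 < D + d := by linarith
  have hA : Real.exp (hypDist z (t * ζ)) = (D + d) / (D - d) := by
    unfold hypDist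
    exact Real.exp_log (div_pos hsum hlt)
  set A := Real.exp (hypDist z (t * ζ))
  have hApos : 0 < A := Real.exp_pos _
  have hsq : (D + d) ^ 2 = A * ((1 - ‖z‖ ^ 2) * (1 - t ^ 2)) := by
    rw [hA, ← key]; field_simp; ring
  have hDsq : D ^ 2 ≤ A * ((1 - ‖z‖ ^ 2) * (1 - t ^ 2)) := by
    rw [← hsq]; gcongr; linarith
  have hDt : 1 - t ≤ D := by
    rw [hDeq]
    have h1 := norm_sub_norm_le (ζ : ℂ) (t * z)
    rw [Circle.norm_coe, norm_mul, Complex.norm_real, Real.norm_of_nonneg ht0] at h1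
    nlinarith
  have hbd : (1 - ‖z‖ ^ 2) * (1 - t ^ 2) ≤ 4 * (1 - ‖z‖) * (1 - t) := by
    have h1 : 1 - ‖z‖ ^ 2 ≤ 2 * (1 - ‖z‖) := by nlinarith
    have h2 : 1 - t ^ 2 ≤ 2 * (1 - t) := by nlinarith
    calc _ ≤ (2 * (1 - ‖z‖)) * (2 * (1 - t)) := mul_le_mul h1 h2 (by nlinarith) (by linarith)
      _ = _ := by ring
  have hDsq' : D ^ 2 ≤ A * (4 * (1 - ‖z‖) * (1 - t)) := hDsq.trans (by gcongr)
  have h1t : 1 - t ≤ 4 * A * (1 - ‖z‖) := by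
    have h1 : 0 < 1 - t := by linarith
    have h2 : (1 - t) ^ 2 ≤ D ^ 2 := by gcongr
    refine le_of_mul_le_mul_right ?_ h1
    linarith [h2.trans hDsq']
  have hDle : D ≤ 4 * A * (1 - ‖z‖) := by
    refine le_of_sq_le_sq ?_ (by positivity) |>.trans le_rfl
    refine hDsq'.trans ?_
    calc A * (4 * (1 - ‖z‖) * (1 - t)) ≤ A * (4 * (1 - ‖z‖) * (4 * A * (1 - ‖z‖))) := by gcongr
      _ = _ := by ring
  have htri : ‖z - ζ‖ ≤ D + (1 - t) * ‖z‖ := by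
    rw [hDeq]
    have h1 : z - ζ = -((ζ : ℂ) - t * z) + ((1 - t : ℝ) : ℂ) * z := by push_cast; ring
    rw [h1]
    refine (norm_add_le _ _).trans ?_
    rw [norm_neg, norm_mul, Complex.norm_real, Real.norm_of_nonneg (by linarith)]
  nlinarith

theorem norm_sub_le_of_hypDistSegment_le {z : ℂ} (hz : ‖z‖ < 1) {ζ : Circle} {a : ℝ}
    (h : hypDistSegment z ζ ≤ a) : ‖z - ζ‖ ≤ 8 * Real.exp (a + 1) * (1 - ‖z‖) := by
  have : Nonempty (Set.Ico (0 : ℝ) 1) := ⟨⟨0, by simp⟩⟩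
  -- Passing from `a` to `a + 1` avoids having to attain the infimum over the segment.
  obtain ⟨t, ht⟩ := exists_lt_of_ciInf_lt (lt_of_le_of_lt h (lt_add_one a))
  refine (norm_sub_le_of_hypDist hz ζ t.2.1 t.2.2).trans ?_
  have : 0 ≤ 1 - ‖z‖ := by linarith
  gcongr

theorem hypDist_zero_right {z : ℂ} : hypDist z 0 = Real.log ((1 + ‖z‖) / (1 - ‖z‖)) := by
  simp [hypDist]

theorem hypDist_zero_right_le {z : ℂ} (hz : ‖z‖ < 1) :
    hypDist z 0 ≤ Real.log 2 - Real.log (1 - ‖z‖) := by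
  have h1 : 0 < 1 - ‖z‖ := by linarith
  have := norm_nonneg z
  rw [hypDist_zero_right, Real.log_div (by positivity) h1.ne']
  have := Real.log_le_log (by positivity) (show 1 + ‖z‖ ≤ 2 by linarith)
  linarith

/-- Exponentiating the allowance `log ρ(z,0)` turns it into a factor `ρ(z,0)`, which is logarithmic
in `1/(1-|z|)`. -/
theorem norm_sub_le_of_mem_enlargedRegion {z : ℂ} {ζ : Circle} {a : ℝ}
    (h : z ∈ enlargedRegion a ζ) :
    ‖z - ζ‖ ≤ 8 * Real.exp (a + 1) * (Real.log 2 - Real.log (1 - ‖z‖)) * (1 - ‖z‖) := by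
  obtain ⟨hz, hz0, hseg⟩ := h
  have h1 : 0 < 1 - ‖z‖ := by linarith
  have hzp : 0 < ‖z‖ := norm_pos_iff.2 hz0
  have hpos : 0 < hypDist z 0 := by
    rw [hypDist_zero_right]
    exact Real.log_pos ((one_lt_div h1).2 (by linarith))
  refine (norm_sub_le_of_hypDistSegment_le hz hseg).trans ?_
  rw [show a + Real.log (hypDist z 0) + 1 = (a + 1) + Real.log (hypDist z 0) by ring,
    Real.exp_add, Real.exp_log hpos, ← mul_assoc]
  gcongr
  exact hypDist_zero_right_le hz

/-! ### Size and continuity of the Poisson kernel and of `P_n`. -/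

theorem one_sub_norm_le_norm_sub (z : ℂ) (ξ : Circle) : 1 - ‖z‖ ≤ ‖(ξ : ℂ) - z‖ := by
  have := norm_sub_norm_le (ξ : ℂ) z
  rwa [Circle.norm_coe] at this

theorem diskPoisson_pos {z : ℂ} (hz : ‖z‖ < 1) (ξ : Circle) : 0 < diskPoisson z ξ := by
  rw [diskPoisson_eq]
  have := one_sub_norm_le_norm_sub z ξ
  have := norm_nonneg z
  refine div_pos (by nlinarith) (pow_pos (by linarith) 2)

theorem diskPoisson_le {z : ℂ} (hz : ‖z‖ < 1) (ξ : Circle) :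
    diskPoisson z ξ ≤ 2 * (1 - ‖z‖) / ‖(ξ : ℂ) - z‖ ^ 2 := by
  rw [diskPoisson_eq]
  have := norm_nonneg z
  gcongr
  nlinarith

theorem le_diskPoisson {z : ℂ} (hz : ‖z‖ < 1) (ξ : Circle) :
    (1 - ‖z‖) / ‖(ξ : ℂ) - z‖ ^ 2 ≤ diskPoisson z ξ := by
  rw [diskPoisson_eq]
  have := norm_nonneg z
  gcongr
  nlinarith

/-- With `δ = 1 - |z|`, one has `δ/4 ≤ P ≤ 2/δ`, and for `δ ≤ 1/4` these bounds lie between `δ²` and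
`δ⁻²`. -/
theorem abs_log_diskPoisson_le {z : ℂ} (hz : ‖z‖ < 1) (hz' : 1 - ‖z‖ ≤ 1 / 4) (ξ : Circle) :
    |Real.log (diskPoisson z ξ)| ≤ 2 * -Real.log (1 - ‖z‖) := by
  have hδ : 0 < 1 - ‖z‖ := by linarith
  have hd := one_sub_norm_le_norm_sub z ξ
  have hd2 : ‖(ξ : ℂ) - z‖ ≤ 2 := by
    refine (norm_sub_le _ _).trans ?_
    rw [Circle.norm_coe]; linarith
  have hP := diskPoisson_pos hz ξ
  have hsq : Real.log ((1 - ‖z‖) ^ 2) = 2 * Real.log (1 - ‖z‖) := by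
    rw [Real.log_pow]; norm_num
  rw [abs_le]
  constructor
  · rw [mul_neg, neg_neg, ← hsq]
    refine Real.log_le_log (by positivity) (le_trans ?_ (le_diskPoisson hz ξ))
    rw [le_div_iff₀ (pow_pos (by linarith) 2)]
    have : ‖(ξ : ℂ) - z‖ ^ 2 ≤ 4 := by nlinarith
    nlinarith
  · rw [mul_neg, ← hsq, ← Real.log_inv]
    refine Real.log_le_log hP ((diskPoisson_le hz ξ).trans ?_)
    rw [div_le_iff₀ (pow_pos (by linarith) 2), inv_mul_eq_div, le_div_iff₀ (by positivity)]
    have : (1 - ‖z‖) ^ 2 ≤ ‖(ξ : ℂ) - z‖ ^ 2 := by gcongr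
    nlinarith

theorem norm_polyKernel_of_ne (n : ℕ) {lam : ℂ} (hlam : lam ≠ -1 / 4) {z : ℂ} (hz : ‖z‖ < 1)
    (ξ : Circle) :
    ‖polyKernel n lam z ξ‖ = 1 / ((n.factorial : ℝ) * (2 * ‖sOf lam‖) ^ n)
      * |Real.log (diskPoisson z ξ)| ^ n * diskPoisson z ξ ^ ((sOf lam).re + 1 / 2) := by
  rw [polyKernel, if_neg hlam, norm_mul, norm_mul, norm_div, norm_mul, norm_pow, norm_pow,
    Complex.norm_cpow_eq_rpow_re_of_pos (diskPoisson_pos hz ξ)]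
  have h : ‖-(busemann z ξ : ℂ)‖ = |Real.log (diskPoisson z ξ)| := by
    rw [busemann, ← Complex.ofReal_neg, neg_neg, Complex.norm_real, Real.norm_eq_abs]
  rw [h]
  simp

theorem polyKernel_neg_quarter (n : ℕ) {z : ℂ} (hz : ‖z‖ < 1) (ξ : Circle) :
    polyKernel n (-1 / 4) z ξ = ((1 / ((2 * n).factorial : ℝ)
      * |Real.log (diskPoisson z ξ)| ^ (2 * n) * diskPoisson z ξ ^ (1 / 2 : ℝ) : ℝ) : ℂ) := by
  rw [polyKernel, if_pos rfl, busemann, (even_two_mul n).pow_abs]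
  push_cast
  rw [Complex.ofReal_cpow (diskPoisson_pos hz ξ).le, (even_two_mul n).neg_pow]
  push_cast
  rfl

theorem continuous_diskPoisson {z : ℂ} (hz : ‖z‖ < 1) : Continuous (diskPoisson z) := by
  have h : diskPoisson z = fun ξ : Circle => (1 - ‖z‖ ^ 2) / ‖(ξ : ℂ) - z‖ ^ 2 :=
    funext fun ξ => diskPoisson_eq z ξ
  rw [h]
  refine continuous_const.div (by fun_prop) fun ξ => ?_
  have := one_sub_norm_le_norm_sub z ξ
  have : 0 < ‖(ξ : ℂ) - z‖ := by linarith
  positivity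

theorem continuous_polyKernel (n : ℕ) (lam : ℂ) {z : ℂ} (hz : ‖z‖ < 1) :
    Continuous (polyKernel n lam z) := by
  have hP := continuous_diskPoisson hz
  have hPc : Continuous fun ξ => (diskPoisson z ξ : ℂ) := Complex.continuous_ofReal.comp hP
  have hb : Continuous fun ξ => (busemann z ξ : ℂ) :=
    Complex.continuous_ofReal.comp (hP.log fun ξ => (diskPoisson_pos hz ξ).ne').neg
  have hc : ∀ w : ℂ, Continuous fun ξ => (diskPoisson z ξ : ℂ) ^ w := fun w =>
    hPc.cpow continuous_const fun ξ => Complex.ofReal_mem_slitPlane.2 (diskPoisson_pos hz ξ)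
  unfold polyKernel
  split_ifs
  · exact (continuous_const.mul (hb.pow _)).mul (hc _)
  · exact (continuous_const.mul (hb.neg.pow _)).mul (hc _)

/-! ### Lower bounds for `Φ_n` near the circle. -/

/-- Write `Γ(w)(1+x²)^(-w)` as `∫ t^(w-1) exp(-(1+x²)t) dt`, exchange the integrals and evaluate the
Gaussian in `x`. The factor `√(π/t)` lowers the exponent by `1/2`; absolute convergence is that of
`Γ(Re w - 1/2)`. -/
theorem Gamma_mul_integral_one_add_sq_cpow {w : ℂ} (hw : 1 / 2 < w.re) :
    (∫ x : ℝ, (1 / ((1 + x ^ 2 : ℝ) : ℂ)) ^ w) * Complex.Gamma w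
      = (√π : ℂ) * Complex.Gamma (w - 1 / 2) := by
  have hw0 : 0 < w.re := by linarith
  have hw2 : 0 < (w - 1 / 2).re := by simp; linarith
  set f : ℝ → ℝ → ℂ := fun x t => (t : ℂ) ^ (w - 1) * Complex.exp (-(((1 + x ^ 2 : ℝ) : ℂ) * t))
  have hmeas : AEStronglyMeasurable (Function.uncurry f)
      ((volume : Measure ℝ).prod (volume.restrict (Set.Ioi 0))) := by
    refine Measurable.aestronglyMeasurable ?_
    have h1 : Measurable fun p : ℝ × ℝ => ((p.2 : ℝ) : ℂ) ^ (w - 1) :=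
      (Complex.measurable_ofReal.comp measurable_snd).pow_const _
    have h2 : Continuous fun p : ℝ × ℝ => Complex.exp (-(((1 + p.1 ^ 2 : ℝ) : ℂ) * p.2)) := by
      fun_prop
    exact h1.mul h2.measurable
  have hnorm : ∀ x t : ℝ, 0 < t → ‖f x t‖
      = t ^ (w.re - 1) * Real.exp (-t) * Real.exp (-t * x ^ 2) := by
    intro x t ht
    simp only [f]
    rw [norm_mul, Complex.norm_cpow_eq_rpow_re_of_pos ht, Complex.norm_exp, mul_assoc,
      ← Real.exp_add, ← Complex.ofReal_mul, ← Complex.ofReal_neg, Complex.ofReal_re]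
    congr 2
    ring
  have hexp : ∀ t : ℝ, 0 < t → Integrable fun x : ℝ => Real.exp (-t * x ^ 2) := fun t ht =>
    integrable_exp_neg_mul_sq ht
  have hint : Integrable (Function.uncurry f)
      ((volume : Measure ℝ).prod (volume.restrict (Set.Ioi 0))) := by
    rw [integrable_prod_iff' hmeas]
    constructor
    · filter_upwards [ae_restrict_mem measurableSet_Ioi] with t ht
      have hm : AEStronglyMeasurable (fun x => Function.uncurry f (x, t)) volume := by
        refine Continuous.aestronglyMeasurable ?_
        simp only [Function.uncurry, f]
        fun_prop
      refine (integrable_norm_iff hm).1 ?_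
      simp only [Function.uncurry]
      simp only [hnorm _ t ht]
      exact (hexp t ht).const_mul _
    · have hG := Real.GammaIntegral_convergent (s := w.re - 1 / 2) (by linarith)
      refine (hG.const_mul (√π)).congr ?_
      filter_upwards [ae_restrict_mem measurableSet_Ioi] with t ht
      have ht' : 0 < t := ht
      simp only [Function.uncurry, hnorm _ t ht, integral_const_mul, integral_gaussian]
      rw [show w.re - 1 / 2 - 1 = (w.re - 1) + -(1 / 2) by ring, Real.rpow_add ht',
        Real.rpow_neg ht'.le, Real.sqrt_div' _ ht'.le, Real.sqrt_eq_rpow t]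
      ring
  have hswap := integral_integral_swap hint
  rw [← integral_mul_const]
  have hleft : ∀ x : ℝ, (1 / ((1 + x ^ 2 : ℝ) : ℂ)) ^ w * Complex.Gamma w
      = ∫ t in Set.Ioi (0 : ℝ), f x t := fun x =>
    (Complex.integral_cpow_mul_exp_neg_mul_Ioi hw0
      (show 0 < 1 + x ^ 2 by positivity)).symm
  simp only [hleft]
  rw [hswap, Complex.Gamma_eq_integral hw2, Complex.GammaIntegral, ← integral_const_mul]
  refine setIntegral_congr_fun measurableSet_Ioi fun t ht => ?_
  have ht' : 0 < t := ht
  have h1 : ∀ x : ℝ, f x t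
      = ((t : ℂ) ^ (w - 1) * (Real.exp (-t) : ℂ)) * ((Real.exp (-t * x ^ 2) : ℝ) : ℂ) := by
    intro x
    simp only [f]
    push_cast
    rw [mul_assoc, ← Complex.exp_add]
    congr 2
    ring
  simp only [h1]
  rw [integral_const_mul, integral_complex_ofReal, integral_gaussian,
    Real.sqrt_div' _ ht'.le, Real.sqrt_eq_rpow t, Complex.ofReal_div,
    Complex.ofReal_cpow ht'.le,
    show w - 1 / 2 - 1 = (w - 1) + -((1 / 2 : ℝ) : ℂ) by push_cast; ring,
    Complex.cpow_add _ _ (Complex.ofReal_ne_zero.2 ht'.ne'), Complex.cpow_neg]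
  ring

theorem integral_two_div_one_add_sq_cpow_ne_zero {w : ℂ} (hw : 1 / 2 < w.re) :
    ∫ x : ℝ, ((2 / (1 + x ^ 2) : ℝ) : ℂ) ^ w ≠ 0 := by
  have h1 : ∀ x : ℝ, ((2 / (1 + x ^ 2) : ℝ) : ℂ) ^ w
      = (2 : ℂ) ^ w * (1 / ((1 + x ^ 2 : ℝ) : ℂ)) ^ w := by
    intro x
    rw [div_eq_mul_one_div, Complex.ofReal_mul,
      Complex.mul_cpow_ofReal_nonneg (by norm_num) (by positivity)]
    push_cast
    rfl
  simp only [h1]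
  rw [integral_const_mul]
  refine mul_ne_zero (by simp [Complex.cpow_eq_zero_iff]) fun h => ?_
  have key := Gamma_mul_integral_one_add_sq_cpow hw
  rw [h, zero_mul] at key
  refine mul_ne_zero ?_ (Complex.Gamma_ne_zero_of_re_pos (s := w - 1 / 2) ?_) key.symm
  · rw [Complex.ofReal_ne_zero]
    exact (Real.sqrt_pos.2 Real.pi_pos).ne'
  · simp; linarith

theorem norm_exp_sub_sq (r φ : ℝ) :
    ‖(Circle.exp φ : ℂ) - r‖ ^ 2 = (1 - r) ^ 2 + 4 * r * Real.sin (φ / 2) ^ 2 := by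
  rw [Circle.coe_exp, ← Complex.normSq_eq_norm_sq, Complex.normSq_apply]
  simp only [Complex.sub_re, Complex.sub_im, Complex.exp_ofReal_mul_I_re,
    Complex.exp_ofReal_mul_I_im, Complex.ofReal_re, Complex.ofReal_im]
  have h1 := Real.cos_two_mul (φ / 2)
  rw [mul_div_cancel₀ _ two_ne_zero] at h1
  have h2 := Real.sin_sq_add_cos_sq (φ / 2)
  have h3 := Real.sin_sq_add_cos_sq φ
  have h4 : Real.cos φ = 1 - 2 * Real.sin (φ / 2) ^ 2 := by rw [h1]; linarith
  linear_combination h3 - 2 * r * h4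

theorem diskPoisson_ofReal_exp {r : ℝ} (φ : ℝ) :
    diskPoisson r (Circle.exp φ)
      = (1 - r ^ 2) / ((1 - r) ^ 2 + 4 * r * Real.sin (φ / 2) ^ 2) := by
  rw [diskPoisson_eq, norm_exp_sub_sq, Complex.norm_real, Real.norm_eq_abs, sq_abs]

theorem diskPoisson_mul_left (u : Circle) (z : ℂ) (ξ : Circle) :
    diskPoisson (u * z) (u * ξ) = diskPoisson z ξ := by
  rw [diskPoisson_eq, diskPoisson_eq, Circle.coe_mul, ← mul_sub, norm_mul, norm_mul,
    Circle.norm_coe, one_mul, one_mul]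

theorem polyspherical_eq_norm (n : ℕ) (lam z : ℂ) :
    polyspherical n lam z = polyspherical n lam (‖z‖ : ℝ) := by
  obtain ⟨φ, hφ⟩ : ∃ φ : ℝ, z = (Circle.exp φ : ℂ) * (‖z‖ : ℝ) :=
    ⟨Complex.arg z, by rw [Circle.coe_exp, mul_comm]; exact (Complex.norm_mul_exp_arg_mul_I z).symm⟩
  conv_lhs => rw [hφ]
  unfold polyspherical
  rw [← integral_arcLength_mul_left _ (Circle.exp φ)]
  simp only [polyKernel, busemann, diskPoisson_mul_left]

theorem polyspherical_eq_intervalIntegral (n : ℕ) (lam : ℂ) {z : ℂ} (hz : ‖z‖ < 1) :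
    polyspherical n lam z
      = (2 * π)⁻¹ • ∫ φ in (-π)..π, polyKernel n lam (‖z‖ : ℝ) (Circle.exp φ) := by
  rw [polyspherical_eq_norm]
  exact integral_arcLength (continuous_polyKernel n lam (by simpa using hz))

/-- With `δ = q⁴`, the kernel is comparable to `δ/φ²` on `[q, 1]`. There `φ` is large enough for `P
≤ q`, so `|log P|` is at least a quarter of `-log δ`, and yet the range spans a logarithmic length
`-log q`. -/
theorem neg_log_le_abs_log_and_le_diskPoisson_rpow {q φ : ℝ} (hq : 0 < q) (hq' : q ≤ 1 / 16)
    (hφ : q ≤ φ) (hφ' : φ ≤ 1) :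
    -Real.log q ≤ |Real.log (diskPoisson ((1 - q ^ 4 : ℝ) : ℂ) (Circle.exp φ))| ∧
      q ^ 2 / (2 * φ) ≤ diskPoisson ((1 - q ^ 4 : ℝ) : ℂ) (Circle.exp φ) ^ (1 / 2 : ℝ) := by
  have hφ0 : 0 < φ := by linarith
  have hq4 : q ^ 4 ≤ q := by
    have : q ^ 3 ≤ 1 := pow_le_one₀ hq.le (by linarith)
    nlinarith
  have hq40 : 0 < q ^ 4 := by positivity
  have hpi := Real.pi_pos
  set P := diskPoisson ((1 - q ^ 4 : ℝ) : ℂ) (Circle.exp φ)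
  have hn : ‖((1 - q ^ 4 : ℝ) : ℂ)‖ = 1 - q ^ 4 := by
    rw [Complex.norm_real, Real.norm_of_nonneg (by linarith)]
  have hz : ‖((1 - q ^ 4 : ℝ) : ℂ)‖ < 1 := by rw [hn]; linarith
  have hP : 0 < P := diskPoisson_pos hz _
  have h1 := le_diskPoisson hz (Circle.exp φ)
  have h2 := diskPoisson_le hz (Circle.exp φ)
  rw [hn, sub_sub_cancel, norm_exp_sub_sq] at h1 h2
  rw [sub_sub_cancel] at h1 h2
  set S := Real.sin (φ / 2)
  have hS1 : S ^ 2 ≤ (φ / 2) ^ 2 := by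
    rw [sq_le_sq]; exact Real.abs_sin_le_abs
  have hS2 : (φ / π) ^ 2 ≤ S ^ 2 := by
    have h := Real.mul_abs_le_abs_sin (x := φ / 2)
      (by rw [abs_of_pos (by linarith)]; linarith [Real.pi_gt_three])
    rw [abs_of_pos (by linarith : 0 < φ / 2)] at h
    rw [sq_le_sq, abs_of_pos (by positivity)]
    refine le_trans (le_of_eq ?_) h
    field_simp
  have hφq : (q ^ 4) ^ 2 ≤ φ ^ 2 := by
    have : q ^ 4 ≤ φ := by linarith
    gcongr
  have hden : (q ^ 4) ^ 2 + 4 * (1 - q ^ 4) * S ^ 2 ≤ 4 * φ ^ 2 := by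
    nlinarith [sq_nonneg S]
  have hdenpos : 0 < (q ^ 4) ^ 2 + 4 * (1 - q ^ 4) * S ^ 2 := by
    have : 0 ≤ 4 * (1 - q ^ 4) * S ^ 2 := mul_nonneg (by linarith) (sq_nonneg _)
    positivity
  have hden2 : 2 * (φ / π) ^ 2 ≤ (q ^ 4) ^ 2 + 4 * (1 - q ^ 4) * S ^ 2 := by
    nlinarith [sq_nonneg S]
  constructor
  · have hle : P ≤ q := by
      refine h2.trans ?_
      have h16 : q * π ^ 2 ≤ 1 := by nlinarith [Real.pi_lt_four]
      calc 2 * q ^ 4 / ((q ^ 4) ^ 2 + 4 * (1 - q ^ 4) * S ^ 2)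
          ≤ 2 * q ^ 4 / (2 * (φ / π) ^ 2) := by gcongr
        _ = q ^ 4 * π ^ 2 / φ ^ 2 := by field_simp
        _ ≤ q ^ 4 * π ^ 2 / q ^ 2 := by gcongr
        _ = q * (q * π ^ 2) := by field_simp
        _ ≤ q * 1 := by gcongr
        _ = q := mul_one q
    rw [abs_of_neg (Real.log_neg hP (by linarith))]
    exact neg_le_neg (Real.log_le_log hP hle)
  · have hsq : (q ^ 2 / (2 * φ)) ^ 2 ≤ P := by
      refine le_trans ?_ h1
      rw [div_pow, ← pow_mul]
      refine div_le_div_of_nonneg_left (by positivity) hdenpos (hden.trans (le_of_eq ?_))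
      ring
    rw [← Real.sqrt_eq_rpow]
    exact Real.le_sqrt_of_sq_le hsq

theorem exists_le_norm_polyspherical_neg_quarter (n : ℕ) :
    ∃ c : ℝ, 0 < c ∧ ∀ᶠ δ in 𝓝[>] (0 : ℝ), ∀ z : ℂ, ‖z‖ = 1 - δ →
      c * (-Real.log δ) ^ (2 * n + 1) * δ ^ (1 / 2 : ℝ) ≤ ‖polyspherical n (-1 / 4) z‖ := by
  have hpi := Real.pi_pos
  -- Since `-log q = (-log δ)/4`, the power `(-log q)^(2n+1)` contributes `(1/4)^(2n) · 1/4`; the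
  -- remaining `1/2` comes from `q²/(2φ)`.
  refine ⟨(2 * π)⁻¹ * (1 / ((2 * n).factorial : ℝ)) * (1 / 4) ^ (2 * n) * (1 / 8), by positivity, ?_⟩
  filter_upwards [Ioo_mem_nhdsGT (show (0 : ℝ) < (1 / 16) ^ 4 by norm_num)] with δ hδ z hz
  obtain ⟨q, hq, hq', rfl⟩ : ∃ q : ℝ, 0 < q ∧ q ≤ 1 / 16 ∧ q ^ 4 = δ := by
    refine ⟨δ ^ (1 / 4 : ℝ), Real.rpow_pos_of_pos hδ.1 _, ?_, ?_⟩
    · have h1 : δ ^ (1 / 4 : ℝ) ≤ (((1 : ℝ) / 16) ^ 4) ^ (1 / 4 : ℝ) :=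
        Real.rpow_le_rpow hδ.1.le hδ.2.le (by norm_num)
      rw [← Real.rpow_natCast, ← Real.rpow_mul (by norm_num)] at h1
      simpa using h1
    · rw [← Real.rpow_natCast, ← Real.rpow_mul hδ.1.le]
      norm_num
  have hq1 : q < 1 := by linarith
  have hz1 : ‖z‖ < 1 := by rw [hz]; linarith [hδ.1]
  have hn : ‖((1 - q ^ 4 : ℝ) : ℂ)‖ = 1 - q ^ 4 := by rw [← hz]; simp
  have hr1 : ‖((1 - q ^ 4 : ℝ) : ℂ)‖ < 1 := by rw [hn]; linarith [hδ.1]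
  set R : ℝ → ℝ := fun φ => 1 / ((2 * n).factorial : ℝ)
    * |Real.log (diskPoisson ((1 - q ^ 4 : ℝ) : ℂ) (Circle.exp φ))| ^ (2 * n)
      * diskPoisson ((1 - q ^ 4 : ℝ) : ℂ) (Circle.exp φ) ^ (1 / 2 : ℝ)
  have hPc : Continuous fun φ => diskPoisson ((1 - q ^ 4 : ℝ) : ℂ) (Circle.exp φ) :=
    (continuous_diskPoisson hr1).comp Circle.exp.continuous
  have hRc : Continuous R := by
    refine (continuous_const.mul ((hPc.log fun φ => (diskPoisson_pos hr1 _).ne').abs.pow _)).mul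
      (hPc.rpow_const fun φ => Or.inl (diskPoisson_pos hr1 _).ne')
  have hR0 : ∀ φ, 0 ≤ R φ := fun φ => by
    have := diskPoisson_pos hr1 (Circle.exp φ)
    positivity
  have hΦ : polyspherical n (-1 / 4) z = (((2 * π)⁻¹ * ∫ φ in (-π)..π, R φ : ℝ) : ℂ) := by
    rw [polyspherical_eq_intervalIntegral n _ hz1, hz]
    simp only [polyKernel_neg_quarter n hr1]
    rw [intervalIntegral.integral_ofReal, Complex.real_smul, Complex.ofReal_mul]
  set K : ℝ := 1 / ((2 * n).factorial : ℝ) * (-Real.log q) ^ (2 * n) * (q ^ 2 / 2)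
  have hlogq : 0 < -Real.log q := by linarith [Real.log_neg hq hq1]
  have hlow : K * -Real.log q ≤ ∫ φ in (-π)..π, R φ := by
    -- The profile `1/φ` integrates to `-log q`: this is the extra logarithm special to `λ = -1/4`.
    calc K * -Real.log q = ∫ φ in q..1, K * φ⁻¹ := by
          rw [intervalIntegral.integral_const_mul, integral_inv_of_pos hq one_pos, one_div,
            Real.log_inv]
      _ ≤ ∫ φ in q..1, R φ := by
          refine intervalIntegral.integral_mono_on hq1.le ?_ (hRc.intervalIntegrable _ _) ?_
          · refine ContinuousOn.intervalIntegrable ?_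
            rw [Set.uIcc_of_le hq1.le]
            exact continuousOn_const.mul (continuousOn_id.inv₀ fun x hx =>
              (lt_of_lt_of_le hq hx.1).ne')
          · intro φ hφ
            obtain ⟨h1, h2⟩ := neg_log_le_abs_log_and_le_diskPoisson_rpow hq hq' hφ.1 hφ.2
            have hφ0 : 0 < φ := lt_of_lt_of_le hq hφ.1
            calc K * φ⁻¹ = 1 / ((2 * n).factorial : ℝ) * (-Real.log q) ^ (2 * n)
                  * (q ^ 2 / (2 * φ)) := by simp only [K]; field_simp
              _ ≤ R φ := by simp only [R]; gcongr
      _ ≤ ∫ φ in (-π)..π, R φ :=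
          intervalIntegral.integral_mono_interval (by linarith) hq1.le
            (by linarith [Real.pi_gt_three]) (Eventually.of_forall hR0)
            (hRc.intervalIntegrable _ _)
  rw [hΦ, Complex.norm_real, Real.norm_of_nonneg]
  · have hlog : -Real.log (q ^ 4) = 4 * -Real.log q := by rw [Real.log_pow]; push_cast; ring
    have hsq : (q ^ 4) ^ (1 / 2 : ℝ) = q ^ 2 := by
      rw [← Real.sqrt_eq_rpow, show q ^ 4 = (q ^ 2) ^ 2 by ring, Real.sqrt_sq (by positivity)]
    rw [hlog, hsq]
    refine le_trans (le_of_eq ?_) (mul_le_mul_of_nonneg_left hlow (by positivity))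
    simp only [K]
    rw [pow_succ, mul_pow 4 (-Real.log q), one_div_pow]
    field_simp
    ring
  · exact mul_nonneg (by positivity)
      (intervalIntegral.integral_nonneg (by linarith) fun φ _ => hR0 φ)

/-- The rescaled integrand of `∫ (log P)^n P^w` at radius `1 - δ`. -/
def scaledKernel (n : ℕ) (w : ℂ) (δ x : ℝ) : ℂ :=
  ((Real.log (diskPoisson ((1 - δ : ℝ) : ℂ) (Circle.exp (δ * x))) / -Real.log δ : ℝ) : ℂ) ^ n
    * ((δ * diskPoisson ((1 - δ : ℝ) : ℂ) (Circle.exp (δ * x)) : ℝ) : ℂ) ^ w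

theorem norm_one_sub_ofReal {δ : ℝ} (h : δ ≤ 1) : ‖((1 - δ : ℝ) : ℂ)‖ = 1 - δ := by
  rw [Complex.norm_real, Real.norm_of_nonneg (by linarith)]

theorem continuous_scaledKernel (n : ℕ) (w : ℂ) {δ : ℝ} (h0 : 0 < δ) (h1 : δ ≤ 1) :
    Continuous (scaledKernel n w δ) := by
  have hz : ‖((1 - δ : ℝ) : ℂ)‖ < 1 := by rw [norm_one_sub_ofReal h1]; linarith
  have hP : Continuous fun x : ℝ => diskPoisson ((1 - δ : ℝ) : ℂ) (Circle.exp (δ * x)) :=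
    (continuous_diskPoisson hz).comp (by fun_prop)
  refine ((Complex.continuous_ofReal.comp ((hP.log fun x => (diskPoisson_pos hz _).ne').div_const
    _)).pow n).mul ((Complex.continuous_ofReal.comp (continuous_const.mul hP)).cpow
    continuous_const fun x => ?_)
  exact Complex.ofReal_mem_slitPlane.2 (mul_pos h0 (diskPoisson_pos hz _))

/-- Uniform in `δ`, this supplies the dominating function: its power `Re w > 1/2` is integrable over
the line. -/
theorem scaled_diskPoisson_le {δ x : ℝ} (h0 : 0 < δ) (h1 : δ ≤ 1 / 4)
    (hx : |x| ≤ π / δ) :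
    δ * diskPoisson ((1 - δ : ℝ) : ℂ) (Circle.exp (δ * x)) ≤ π ^ 2 / (1 + x ^ 2) := by
  have hpi := Real.pi_pos
  rw [diskPoisson_ofReal_exp, sub_sub_cancel]
  have hxδ : |δ * x / 2| = δ * |x| / 2 := by rw [abs_div, abs_mul, abs_of_pos h0, abs_two]
  have hS : (δ * x / π) ^ 2 ≤ Real.sin (δ * x / 2) ^ 2 := by
    have h := Real.mul_abs_le_abs_sin (x := δ * x / 2) (by
      rw [hxδ]
      rw [le_div_iff₀ h0] at hx
      linarith)
    rw [sq_le_sq]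
    refine le_trans (le_of_eq ?_) h
    rw [hxδ, abs_div, abs_mul, abs_of_pos h0, abs_of_pos hpi]
    field_simp
  have hden : 2 / π ^ 2 * (δ ^ 2 * (1 + x ^ 2))
      ≤ δ ^ 2 + 4 * (1 - δ) * Real.sin (δ * x / 2) ^ 2 := by
    have h2 : 2 / π ^ 2 ≤ 1 := by
      rw [div_le_one (by positivity)]
      nlinarith [Real.pi_gt_three]
    have h3 : 2 / π ^ 2 * (δ ^ 2 * x ^ 2) = 2 * (δ * x / π) ^ 2 := by field_simp
    have h4 : 2 / π ^ 2 * δ ^ 2 ≤ 1 * δ ^ 2 := by gcongr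
    nlinarith [sq_nonneg (Real.sin (δ * x / 2))]
  calc δ * ((1 - (1 - δ) ^ 2) / (δ ^ 2 + 4 * (1 - δ) * Real.sin (δ * x / 2) ^ 2))
      ≤ δ * ((2 * δ) / (2 / π ^ 2 * (δ ^ 2 * (1 + x ^ 2)))) := by
        gcongr
        nlinarith
    _ = π ^ 2 / (1 + x ^ 2) := by field_simp

theorem norm_scaledKernel_le (n : ℕ) {w : ℂ} (hw : 0 ≤ w.re) {δ x : ℝ} (h0 : 0 < δ)
    (h1 : δ ≤ 1 / 4) (hx : |x| ≤ π / δ) :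
    ‖scaledKernel n w δ x‖ ≤ 2 ^ n * (π ^ 2 / (1 + x ^ 2)) ^ w.re := by
  have hn := norm_one_sub_ofReal (by linarith : δ ≤ 1)
  have hz : ‖((1 - δ : ℝ) : ℂ)‖ < 1 := by rw [hn]; linarith
  have hP := diskPoisson_pos hz (Circle.exp (δ * x))
  have hL : 0 < -Real.log δ := by linarith [Real.log_neg h0 (by linarith)]
  have hlog := abs_log_diskPoisson_le hz (by rw [hn]; linarith) (Circle.exp (δ * x))
  rw [hn, sub_sub_cancel] at hlog
  rw [scaledKernel, norm_mul, norm_pow, Complex.norm_real, Real.norm_eq_abs, abs_div,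
    abs_of_pos hL, Complex.norm_cpow_eq_rpow_re_of_pos (by positivity)]
  gcongr
  · rwa [div_le_iff₀ hL]
  · exact scaled_diskPoisson_le h0 h1 hx

theorem tendsto_scaled_diskPoisson (x : ℝ) :
    Tendsto (fun δ : ℝ => δ * diskPoisson ((1 - δ : ℝ) : ℂ) (Circle.exp (δ * x))) (𝓝[>] 0)
      (𝓝 (2 / (1 + x ^ 2))) := by
  have hs : Tendsto (fun δ : ℝ => Real.sin (δ * x / 2) / δ) (𝓝[>] 0) (𝓝 (x / 2)) := by
    have hd : HasDerivAt (fun δ : ℝ => Real.sin (δ * x / 2)) (x / 2) 0 := by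
      have h := (((hasDerivAt_id (0 : ℝ)).mul_const x).div_const 2).sin
      simpa using h
    refine hd.tendsto_slope_zero_right.congr fun δ => ?_
    simp [div_eq_inv_mul]
  have h1 : Tendsto (fun δ : ℝ => δ) (𝓝[>] 0) (𝓝 0) := tendsto_id.mono_left nhdsWithin_le_nhds
  have hlim : Tendsto (fun δ : ℝ => (2 - δ)
      / (1 + 4 * (1 - δ) * (Real.sin (δ * x / 2) / δ) ^ 2)) (𝓝[>] 0)
      (𝓝 ((2 - 0) / (1 + 4 * (1 - 0) * (x / 2) ^ 2))) := by
    refine (h1.const_sub 2).div ((((h1.const_sub 1).const_mul 4).mul (hs.pow 2)).const_add 1) ?_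
    positivity
  rw [show (2 : ℝ) / (1 + x ^ 2) = (2 - 0) / (1 + 4 * (1 - 0) * (x / 2) ^ 2) by
    congr 1 <;> ring]
  refine hlim.congr' ?_
  filter_upwards [self_mem_nhdsWithin] with δ hδ
  have hδ' : (0 : ℝ) < δ := hδ
  rw [diskPoisson_ofReal_exp, sub_sub_cancel]
  have : 1 + 4 * (1 - δ) * (Real.sin (δ * x / 2) / δ) ^ 2
      = (δ ^ 2 + 4 * (1 - δ) * Real.sin (δ * x / 2) ^ 2) / δ ^ 2 := by
    field_simp
  rw [this, div_div_eq_mul_div, mul_div_assoc']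
  congr 1
  ring

/-- Since `log P = log(δP) - log δ` and `δP` has a positive limit, the normalised logarithm tends to
`1`. The limit therefore does not depend on `n`. -/
theorem tendsto_scaledKernel (n : ℕ) (w : ℂ) (x : ℝ) :
    Tendsto (fun δ => scaledKernel n w δ x) (𝓝[>] 0) (𝓝 (((2 / (1 + x ^ 2) : ℝ) : ℂ) ^ w)) := by
  have hP := tendsto_scaled_diskPoisson x
  have hpos : (0 : ℝ) < 2 / (1 + x ^ 2) := by positivity
  have hL : Tendsto (fun δ : ℝ => -Real.log δ) (𝓝[>] 0) atTop :=
    tendsto_neg_atBot_atTop.comp Real.tendsto_log_nhdsGT_zero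
  have h1 : Tendsto (fun δ : ℝ =>
      Real.log (diskPoisson ((1 - δ : ℝ) : ℂ) (Circle.exp (δ * x))) / -Real.log δ)
      (𝓝[>] 0) (𝓝 1) := by
    have := ((hP.log hpos.ne').div_atTop hL).add_const 1
    rw [zero_add] at this
    refine this.congr' ?_
    filter_upwards [Ioo_mem_nhdsGT one_pos] with δ hδ
    have hz : ‖((1 - δ : ℝ) : ℂ)‖ < 1 := by rw [norm_one_sub_ofReal hδ.2.le]; linarith [hδ.1]
    have hlog : Real.log δ ≠ 0 := (Real.log_neg hδ.1 hδ.2).ne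
    rw [Real.log_mul hδ.1.ne' (diskPoisson_pos hz _).ne']
    field_simp
    ring
  have h2 : Tendsto (fun δ => scaledKernel n w δ x) (𝓝[>] 0)
      (𝓝 (((1 : ℝ) : ℂ) ^ n * ((2 / (1 + x ^ 2) : ℝ) : ℂ) ^ w)) :=
    (((Complex.continuous_ofReal.tendsto _).comp h1).pow n).mul
      (((Complex.continuous_ofReal.tendsto _).comp hP).cpow tendsto_const_nhds
        (Complex.ofReal_mem_slitPlane.2 hpos))
  simpa using h2

theorem tendsto_integral_scaledKernel (n : ℕ) {w : ℂ} (hw : 1 / 2 < w.re) :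
    Tendsto (fun δ => ∫ x in (-(π / δ))..(π / δ), scaledKernel n w δ x) (𝓝[>] 0)
      (𝓝 (∫ x : ℝ, ((2 / (1 + x ^ 2) : ℝ) : ℂ) ^ w)) := by
  have hpi := Real.pi_pos
  have hbound : Integrable fun x : ℝ => (2 : ℝ) ^ n * (π ^ 2 / (1 + x ^ 2)) ^ w.re := by
    have h := (integrable_rpow_neg_one_add_norm_sq (E := ℝ) (μ := volume) (r := 2 * w.re)
      (by simp; linarith)).const_mul (2 ^ n * (π ^ 2) ^ w.re)
    refine h.congr (Eventually.of_forall fun x => ?_)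
    simp only [Real.norm_eq_abs, sq_abs]
    rw [Real.div_rpow (by positivity) (by positivity), show -(2 * w.re) / 2 = -w.re by ring,
      Real.rpow_neg (by positivity)]
    ring
  have key : Tendsto (fun δ : ℝ => ∫ x, (Set.Ioc (-(π / δ)) (π / δ)).indicator
      (scaledKernel n w δ) x) (𝓝[>] 0) (𝓝 (∫ x : ℝ, ((2 / (1 + x ^ 2) : ℝ) : ℂ) ^ w)) := by
    refine tendsto_integral_filter_of_dominated_convergence _ ?_ ?_ hbound ?_
    · filter_upwards [Ioo_mem_nhdsGT one_pos] with δ hδ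
      exact ((continuous_scaledKernel n w hδ.1 hδ.2.le).aestronglyMeasurable).indicator
        measurableSet_Ioc
    · filter_upwards [Ioo_mem_nhdsGT (show (0 : ℝ) < 1 / 4 by norm_num)] with δ hδ
      refine Eventually.of_forall fun x => ?_
      by_cases hx : x ∈ Set.Ioc (-(π / δ)) (π / δ)
      · rw [Set.indicator_of_mem hx]
        exact norm_scaledKernel_le n (by linarith) hδ.1 hδ.2.le (abs_le.2 ⟨hx.1.le, hx.2⟩)
      · rw [Set.indicator_of_notMem hx, norm_zero]
        positivity
    · refine Eventually.of_forall fun x => (tendsto_scaledKernel n w x).congr' ?_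
      filter_upwards [Ioo_mem_nhdsGT (show 0 < π / (|x| + 1) by positivity)] with δ hδ
      have h1 : |x| < π / δ := by
        have := hδ.2
        rw [lt_div_iff₀ (by positivity)] at this
        rw [lt_div_iff₀ hδ.1]
        nlinarith [hδ.1]
      rw [Set.indicator_of_mem (show x ∈ Set.Ioc _ _ from ⟨(abs_lt.1 h1).1, (abs_lt.1 h1).2.le⟩)]
  refine key.congr' ?_
  filter_upwards [self_mem_nhdsWithin] with δ hδ
  have hδ' : (0 : ℝ) < δ := hδ
  rw [integral_indicator measurableSet_Ioc,
    intervalIntegral.integral_of_le (by have : 0 < π / δ := by positivity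
                                        linarith)]

theorem polyKernel_eq_scaledKernel (n : ℕ) {lam : ℂ} (hlam : lam ≠ -1 / 4) {δ : ℝ}
    (h0 : 0 < δ) (h1 : δ < 1) (x : ℝ) :
    polyKernel n lam ((1 - δ : ℝ) : ℂ) (Circle.exp (δ * x))
      = 1 / ((n.factorial : ℂ) * (2 * sOf lam) ^ n) * ((-Real.log δ : ℝ) : ℂ) ^ n
        * (δ : ℂ) ^ (-(sOf lam + 1 / 2)) * scaledKernel n (sOf lam + 1 / 2) δ x := by
  have hz : ‖((1 - δ : ℝ) : ℂ)‖ < 1 := by rw [norm_one_sub_ofReal h1.le]; linarith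
  have hP := diskPoisson_pos hz (Circle.exp (δ * x))
  have hL : ((-Real.log δ : ℝ) : ℂ) ≠ 0 := by
    rw [Complex.ofReal_ne_zero]
    exact (by linarith [Real.log_neg h0 h1] : 0 < -Real.log δ).ne'
  rw [polyKernel, if_neg hlam, scaledKernel, busemann, Complex.ofReal_mul,
    Complex.mul_cpow_ofReal_nonneg h0.le hP.le, Complex.ofReal_div, div_pow, Complex.ofReal_neg,
    neg_neg, Complex.cpow_neg]
  have hδ : (δ : ℂ) ^ (sOf lam + 1 / 2) ≠ 0 := by
    rw [Complex.cpow_ne_zero_iff]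
    exact Or.inl (Complex.ofReal_ne_zero.2 h0.ne')
  have hLn := pow_ne_zero n hL
  generalize sOf lam + 1 / 2 = w at hδ ⊢
  field_simp

/-- The substitution `φ = δx` extracts the factor `L^n δ · δ^(-(s+1/2))`, with `L = -log δ`, and
leaves an integral with nonzero limit, hence eventually of modulus at least half the limiting
modulus `C`. -/
theorem exists_le_norm_polyspherical (n : ℕ) {lam : ℂ} (hlam : lam ≠ -1 / 4)
    (hs : 0 < (sOf lam).re) :
    ∃ c : ℝ, 0 < c ∧ ∀ᶠ δ in 𝓝[>] (0 : ℝ), ∀ z : ℂ, ‖z‖ = 1 - δ →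
      c * (-Real.log δ) ^ n * δ ^ (1 / 2 - (sOf lam).re) ≤ ‖polyspherical n lam z‖ := by
  have hpi := Real.pi_pos
  have hw : 1 / 2 < (sOf lam + 1 / 2).re := by simp; linarith
  have hC := norm_pos_iff.2 (integral_two_div_one_add_sq_cpow_ne_zero hw)
  have hlim := (tendsto_integral_scaledKernel n hw).norm
  set C := ‖∫ x : ℝ, ((2 / (1 + x ^ 2) : ℝ) : ℂ) ^ (sOf lam + 1 / 2)‖
  have hs0 : 0 < ‖sOf lam‖ := norm_pos_iff.2 fun h => by rw [h] at hs; simp at hs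
  refine ⟨(2 * π)⁻¹ * (1 / ((n.factorial : ℝ) * (2 * ‖sOf lam‖) ^ n)) * (C / 2),
    by positivity, ?_⟩
  filter_upwards [hlim.eventually (lt_mem_nhds (half_lt_self hC)), Ioo_mem_nhdsGT one_pos]
    with δ hCδ hδ z hz
  have hz1 : ‖z‖ < 1 := by rw [hz]; linarith [hδ.1]
  have hL : 0 < -Real.log δ := by linarith [Real.log_neg hδ.1 hδ.2]
  have hδ0 := hδ.1
  have hscale : ∫ φ in (-π)..π, polyKernel n lam ((1 - δ : ℝ) : ℂ) (Circle.exp φ)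
      = δ • ∫ x in (-(π / δ))..(π / δ),
          polyKernel n lam ((1 - δ : ℝ) : ℂ) (Circle.exp (δ * x)) := by
    rw [intervalIntegral.integral_comp_mul_left (fun φ => polyKernel n lam ((1 - δ : ℝ) : ℂ)
      (Circle.exp φ)) hδ0.ne', smul_smul, mul_inv_cancel₀ hδ0.ne', one_smul, mul_neg,
      mul_div_cancel₀ _ hδ0.ne']
  have hΦ : polyspherical n lam z = ((2 * π)⁻¹ : ℝ) • ∫ φ in (-π)..π,
      polyKernel n lam ((1 - δ : ℝ) : ℂ) (Circle.exp φ) := by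
    rw [polyspherical_eq_intervalIntegral n lam hz1, hz]
  rw [hΦ, hscale]
  simp only [polyKernel_eq_scaledKernel n hlam hδ.1 hδ.2]
  rw [intervalIntegral.integral_const_mul, norm_smul, norm_smul, norm_mul, norm_mul, norm_mul,
    norm_div, norm_mul, norm_pow, norm_pow, norm_mul, Complex.norm_real,
    Complex.norm_cpow_eq_rpow_re_of_pos hδ0, Real.norm_of_nonneg hL.le, Real.norm_of_nonneg hδ0.le,
    Real.norm_of_nonneg (by positivity : 0 ≤ (2 * π)⁻¹)]
  have hexp : δ ^ (1 / 2 - (sOf lam).re) = δ * δ ^ (-(sOf lam + 1 / 2)).re := by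
    nth_rewrite 2 [← Real.rpow_one δ]
    rw [← Real.rpow_add hδ0]
    congr 1
    simp
    ring
  rw [hexp]
  simp only [norm_one, Complex.norm_natCast, Complex.norm_ofNat]
  set E := δ ^ (-(sOf lam + 1 / 2)).re
  have hE : 0 < E := Real.rpow_pos_of_pos hδ0 _
  calc (2 * π)⁻¹ * (1 / ((n.factorial : ℝ) * (2 * ‖sOf lam‖) ^ n)) * (C / 2)
        * (-Real.log δ) ^ n * (δ * E)
      = (2 * π)⁻¹ * (δ * (1 / ((n.factorial : ℝ) * (2 * ‖sOf lam‖) ^ n)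
        * (-Real.log δ) ^ n * E * (C / 2))) := by ring
    _ ≤ _ := by gcongr

/-! ### The principal root, and zero-freeness of `Φ_0`. -/

theorem sOf_sq (lam : ℂ) : sOf lam ^ 2 = lam + 1 / 4 := by
  unfold sOf
  rw [show (1 / 2 : ℂ) = ((2 : ℕ) : ℂ)⁻¹ by norm_num]
  exact Complex.cpow_nat_inv_pow _ two_ne_zero

/-- Off the cut `(-∞, -1/4]` the argument of `lam + 1/4` is less than `π` in modulus, so that of its
root is less than `π/2`. -/
theorem sOf_re_pos {lam : ℂ} (h : ¬(lam.im = 0 ∧ lam.re < -1 / 4)) (h' : lam ≠ -1 / 4) :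
    0 < (sOf lam).re := by
  have hne : lam + 1 / 4 ≠ 0 := fun h0 => h' (by linear_combination h0)
  have harg : Complex.arg (lam + 1 / 4) < π := by
    refine lt_of_le_of_ne (Complex.arg_le_pi _) fun h1 => h ?_
    rw [Complex.arg_eq_pi_iff] at h1
    norm_num at h1
    exact ⟨h1.2, by linarith [h1.1]⟩
  have harg' := Complex.neg_pi_lt_arg (lam + 1 / 4)
  rw [sOf, Complex.cpow_def_of_ne_zero hne, Complex.exp_re]
  refine mul_pos (Real.exp_pos _) (Real.cos_pos_of_mem_Ioo ?_)
  have : (Complex.log (lam + 1 / 4) * (1 / 2)).im = Complex.arg (lam + 1 / 4) / 2 := by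
    rw [show (1 / 2 : ℂ) = ((1 / 2 : ℝ) : ℂ) by norm_num, Complex.im_mul_ofReal, Complex.log_im]
    ring
  rw [this]
  constructor <;> linarith

theorem hasDerivAt_intervalIntegral_of_continuous {F F' : ℝ → ℝ → ℂ}
    (hF : ∀ x, Continuous (F x)) (hF' : Continuous (Function.uncurry F'))
    (hd : ∀ x t, HasDerivAt (fun x => F x t) (F' x t) x) (a b x₀ : ℝ) :
    HasDerivAt (fun x => ∫ t in a..b, F x t) (∫ t in a..b, F' x₀ t) x₀ := by
  obtain ⟨C, hC⟩ := ((isCompact_Icc (a := x₀ - 1) (b := x₀ + 1)).prod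
    (isCompact_uIcc (a := a) (b := b))).exists_bound_of_continuousOn hF'.continuousOn
  refine (intervalIntegral.hasDerivAt_integral_of_dominated_loc_of_deriv_le (bound := fun _ => C)
    (Icc_mem_nhds (show x₀ - 1 < x₀ by linarith) (show x₀ < x₀ + 1 by linarith))
    (Eventually.of_forall fun x => (hF x).aestronglyMeasurable)
    ((hF x₀).intervalIntegrable _ _) ?_ ?_ intervalIntegrable_const ?_).2
  · exact (hF'.comp (Continuous.prodMk_right x₀)).aestronglyMeasurable
  · exact Eventually.of_forall fun t ht x hx => hC (x, t) ⟨hx, Set.uIoc_subset_uIcc ht⟩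
  · exact Eventually.of_forall fun t _ x _ => hd x t

/-- The reciprocal of the Poisson kernel in geodesic polar coordinates. -/
def polarDenom (ρ φ : ℝ) : ℝ := Real.cosh ρ - Real.sinh ρ * Real.cos φ

/-- The radial derivative of `polarDenom`. -/
def polarDenom' (ρ φ : ℝ) : ℝ := Real.sinh ρ - Real.cosh ρ * Real.cos φ

theorem polarDenom_pos (ρ φ : ℝ) : 0 < polarDenom ρ φ := by
  have h1 := Real.cosh_sq ρ
  have h2 := Real.cosh_pos ρ
  have h3 : |Real.sinh ρ| < Real.cosh ρ := abs_lt_of_sq_lt_sq (by linarith) h2.le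
  have h4 : Real.sinh ρ * Real.cos φ ≤ |Real.sinh ρ| := by
    refine (le_abs_self _).trans ?_
    rw [abs_mul]
    exact mul_le_of_le_one_right (abs_nonneg _) (Real.abs_cos_le_one _)
  unfold polarDenom
  linarith

/-- The power `P ^ w` of the Poisson kernel in geodesic polar coordinates. -/
def polarPow (w : ℂ) (ρ φ : ℝ) : ℂ := Complex.exp (-w * (Real.log (polarDenom ρ φ) : ℝ))

theorem continuous_polarDenom : Continuous (Function.uncurry polarDenom) := by
  unfold polarDenom Function.uncurry
  have := Real.continuous_cosh
  have := Real.continuous_sinh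
  fun_prop

theorem continuous_polarDenom' : Continuous (Function.uncurry polarDenom') := by
  unfold polarDenom' Function.uncurry
  have := Real.continuous_cosh
  have := Real.continuous_sinh
  fun_prop

theorem continuous_polarPow (w : ℂ) : Continuous (Function.uncurry (polarPow w)) :=
  Complex.continuous_exp.comp (continuous_const.mul (Complex.continuous_ofReal.comp
    (continuous_polarDenom.log fun p => (polarDenom_pos p.1 p.2).ne')))

theorem hasDerivAt_polarDenom (ρ φ : ℝ) :
    HasDerivAt (fun ρ => polarDenom ρ φ) (polarDenom' ρ φ) ρ :=
  (Real.hasDerivAt_cosh ρ).sub ((Real.hasDerivAt_sinh ρ).mul_const _)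

theorem hasDerivAt_polarDenom' (ρ φ : ℝ) :
    HasDerivAt (fun ρ => polarDenom' ρ φ) (polarDenom ρ φ) ρ :=
  (Real.hasDerivAt_sinh ρ).sub ((Real.hasDerivAt_cosh ρ).mul_const _)

theorem hasDerivAt_polarDenom_angle (ρ φ : ℝ) :
    HasDerivAt (fun φ => polarDenom ρ φ) (Real.sinh ρ * Real.sin φ) φ := by
  have := ((Real.hasDerivAt_cos φ).const_mul (Real.sinh ρ)).const_sub (Real.cosh ρ)
  convert! this using 1
  ring

theorem hasDerivAt_cexp_neg_mul_log {g : ℝ → ℝ} {g' x : ℝ} (w : ℂ) (hg : HasDerivAt g g' x)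
    (h0 : g x ≠ 0) :
    HasDerivAt (fun x => Complex.exp (-w * (Real.log (g x) : ℝ)))
      (-w * g' * (g x : ℂ)⁻¹ * Complex.exp (-w * (Real.log (g x) : ℝ))) x := by
  have h := (((hg.log h0).ofReal_comp).const_mul (-w)).cexp
  convert! h using 1
  push_cast
  ring

theorem hasDerivAt_ofReal_inv {g : ℝ → ℝ} {g' x : ℝ} (hg : HasDerivAt g g' x) (h0 : g x ≠ 0) :
    HasDerivAt (fun x => ((g x : ℂ))⁻¹) (-(g' : ℂ) * ((g x : ℂ)⁻¹) ^ 2) x := by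
  have h := (hg.inv h0).ofReal_comp
  convert! h using 1
  · ext y; simp
  · push_cast
    rw [div_eq_mul_inv, inv_pow]

/-- `sinh ρ` times the radial derivative of `polarPow`. -/
def polarFlux (w : ℂ) (ρ φ : ℝ) : ℂ :=
  (Real.sinh ρ : ℂ) * (-w * polarDenom' ρ φ * (polarDenom ρ φ : ℂ)⁻¹ * polarPow w ρ φ)

/-- The angular derivative of `-w * sin φ * P * P ^ w`. -/
def polarAngularDeriv (w : ℂ) (ρ φ : ℝ) : ℂ :=
  -w * ((Real.cos φ : ℂ) * (polarDenom ρ φ : ℂ)⁻¹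
    - Real.sin φ * (Real.sinh ρ * Real.sin φ) * ((polarDenom ρ φ : ℂ)⁻¹) ^ 2) * polarPow w ρ φ
  + w ^ 2 * Real.sin φ * (Real.sinh ρ * Real.sin φ) * ((polarDenom ρ φ : ℂ)⁻¹) ^ 2
    * polarPow w ρ φ

theorem continuous_ofReal_polarDenom_inv :
    Continuous (fun p : ℝ × ℝ => ((polarDenom p.1 p.2 : ℂ))⁻¹) :=
  (Complex.continuous_ofReal.comp continuous_polarDenom).inv₀ fun p =>
    Complex.ofReal_ne_zero.2 (polarDenom_pos p.1 p.2).ne'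

theorem continuous_ofReal_sinh_fst : Continuous fun p : ℝ × ℝ => (Real.sinh p.1 : ℂ) :=
  Complex.continuous_ofReal.comp (Real.continuous_sinh.comp continuous_fst)

theorem continuous_polarFlux (w : ℂ) : Continuous (Function.uncurry (polarFlux w)) :=
  continuous_ofReal_sinh_fst.mul (((continuous_const.mul (Complex.continuous_ofReal.comp
    continuous_polarDenom')).mul continuous_ofReal_polarDenom_inv).mul (continuous_polarPow w))

theorem continuous_polarAngularDeriv (w : ℂ) :
    Continuous (Function.uncurry (polarAngularDeriv w)) := by
  have h1 := continuous_ofReal_polarDenom_inv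
  have h2 := continuous_ofReal_sinh_fst
  have h3 : Continuous fun p : ℝ × ℝ => polarPow w p.1 p.2 := continuous_polarPow w
  have h4 : Continuous fun p : ℝ × ℝ => (Real.sin p.2 : ℂ) :=
    Complex.continuous_ofReal.comp (Real.continuous_sin.comp continuous_snd)
  have h5 : Continuous fun p : ℝ × ℝ => (Real.cos p.2 : ℂ) :=
    Complex.continuous_ofReal.comp (Real.continuous_cos.comp continuous_snd)
  exact ((continuous_const.mul ((h5.mul h1).sub ((h4.mul (h2.mul h4)).mul (h1.pow 2)))).mul
    h3).add ((((continuous_const.mul h4).mul (h2.mul h4)).mul (h1.pow 2)).mul h3)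

theorem hasDerivAt_polarPow (w : ℂ) (ρ φ : ℝ) :
    HasDerivAt (fun ρ => polarPow w ρ φ)
      (-w * polarDenom' ρ φ * (polarDenom ρ φ : ℂ)⁻¹ * polarPow w ρ φ) ρ :=
  hasDerivAt_cexp_neg_mul_log w (hasDerivAt_polarDenom ρ φ) (polarDenom_pos ρ φ).ne'

/-- The eigenvalue equation for `P ^ w` in polar coordinates. -/
theorem hasDerivAt_polarFlux (w : ℂ) (ρ φ : ℝ) :
    HasDerivAt (fun ρ => polarFlux w ρ φ)
      (w * (w - 1) * Real.sinh ρ * polarPow w ρ φ - polarAngularDeriv w ρ φ) ρ := by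
  have hQ := (polarDenom_pos ρ φ).ne'
  have h := (Real.hasDerivAt_sinh ρ).ofReal_comp.mul
    ((((hasDerivAt_polarDenom' ρ φ).ofReal_comp.const_mul (-w)).mul
      (hasDerivAt_ofReal_inv (hasDerivAt_polarDenom ρ φ) hQ)).mul (hasDerivAt_polarPow w ρ φ))
  convert! h using 1
  -- `e1` and `e2` are `cosh² - sinh² = 1` in terms of the denominator and its radial derivative;
  -- with `e3` the equation becomes a polynomial identity. `polarAngularDeriv` is the second angular
  -- derivative already divided by `sinh ρ`, so nothing degenerates at `ρ = 0`.
  have e1 : (polarDenom' ρ φ : ℂ) ^ 2 = (polarDenom ρ φ : ℂ) ^ 2 - (Real.sin φ : ℂ) ^ 2 := by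
    rw [← Complex.ofReal_pow, ← Complex.ofReal_pow, ← Complex.ofReal_pow, ← Complex.ofReal_sub,
      Complex.ofReal_inj, polarDenom, polarDenom']
    linear_combination (Real.cos φ ^ 2 - 1) * Real.cosh_sq ρ + Real.sin_sq_add_cos_sq φ
  have e2 : (Real.cosh ρ : ℂ) * polarDenom' ρ φ
      = Real.sinh ρ * polarDenom ρ φ - Real.cos φ := by
    rw [← Complex.ofReal_mul, ← Complex.ofReal_mul, ← Complex.ofReal_sub,
      Complex.ofReal_inj, polarDenom, polarDenom']
    linear_combination (-Real.cos φ) * Real.cosh_sq ρ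
  have e3 : (polarDenom ρ φ : ℂ) * (polarDenom ρ φ : ℂ)⁻¹ = 1 :=
    mul_inv_cancel₀ (Complex.ofReal_ne_zero.2 hQ)
  rw [polarAngularDeriv]
  simp only [Pi.mul_apply]
  generalize (polarDenom ρ φ : ℂ)⁻¹ = i at *
  generalize (polarDenom ρ φ : ℂ) = q at *
  generalize (polarDenom' ρ φ : ℂ) = R at *
  generalize polarPow w ρ φ = f at *
  generalize (Real.sinh ρ : ℂ) = S at *
  generalize (Real.cosh ρ : ℂ) = C at *
  linear_combination (f * w * i) * e2 - (f * (w + w ^ 2) * S * i ^ 2) * e1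
    + (S * w * f * (1 - w - (1 + w) * (q * i))) * e3

theorem hasDerivAt_polar_angular (w : ℂ) (ρ φ : ℝ) :
    HasDerivAt (fun φ => -w * Real.sin φ * (polarDenom ρ φ : ℂ)⁻¹ * polarPow w ρ φ)
      (polarAngularDeriv w ρ φ) φ := by
  have hQ := (polarDenom_pos ρ φ).ne'
  have hP : HasDerivAt (fun φ => polarPow w ρ φ) _ φ :=
    hasDerivAt_cexp_neg_mul_log w (hasDerivAt_polarDenom_angle ρ φ) hQ
  have h := (((Real.hasDerivAt_sin φ).ofReal_comp.const_mul (-w)).mul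
    (hasDerivAt_ofReal_inv (hasDerivAt_polarDenom_angle ρ φ) hQ)).mul hP
  convert! h using 1
  rw [polarAngularDeriv]
  simp only [polarPow, Pi.mul_apply]
  push_cast
  ring

/-- The spherical function, up to the factor `2π`, as a function of hyperbolic distance. -/
def radialInt (w : ℂ) (ρ : ℝ) : ℂ := ∫ φ in (-π)..π, polarPow w ρ φ

/-- `sinh ρ` times the derivative of `radialInt`. -/
def radialFlux (w : ℂ) (ρ : ℝ) : ℂ := ∫ φ in (-π)..π, polarFlux w ρ φ

theorem hasDerivAt_radialInt (w : ℂ) (ρ : ℝ) :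
    ∃ G' : ℂ, HasDerivAt (radialInt w) G' ρ ∧ radialFlux w ρ = Real.sinh ρ * G' := by
  refine ⟨_, hasDerivAt_intervalIntegral_of_continuous
    (fun x => (continuous_polarPow w).comp (Continuous.prodMk_right x)) ?_
    (hasDerivAt_polarPow w) _ _ _, ?_⟩
  · exact ((continuous_const.mul (Complex.continuous_ofReal.comp
      continuous_polarDenom')).mul continuous_ofReal_polarDenom_inv).mul (continuous_polarPow w)
  · rw [radialFlux, ← intervalIntegral.integral_const_mul]
    rfl

theorem integral_polarAngularDeriv (w : ℂ) (ρ : ℝ) :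
    ∫ φ in (-π)..π, polarAngularDeriv w ρ φ = 0 := by
  have h2 : Continuous (polarAngularDeriv w ρ) :=
    (continuous_polarAngularDeriv w).uncurry_left ρ
  rw [intervalIntegral.integral_eq_sub_of_hasDerivAt
    (fun φ _ => hasDerivAt_polar_angular w ρ φ) (h2.intervalIntegrable _ _)]
  simp

/-- Integrating the eigenvalue equation over the circle removes the angular term, whose primitive
vanishes at `±π`. What remains is the radial equation `(sinh ρ · G')' = w(w-1) sinh ρ · G` for `G =
radialInt w`. -/
theorem hasDerivAt_radialFlux (w : ℂ) (ρ : ℝ) :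
    HasDerivAt (radialFlux w) (w * (w - 1) * Real.sinh ρ * radialInt w ρ) ρ := by
  have hc1 : Continuous fun p : ℝ × ℝ => w * (w - 1) * Real.sinh p.1 * polarPow w p.1 p.2 :=
    (continuous_const.mul continuous_ofReal_sinh_fst).mul (continuous_polarPow w)
  have hc2 : Continuous fun p : ℝ × ℝ => polarAngularDeriv w p.1 p.2 :=
    continuous_polarAngularDeriv w
  have h := hasDerivAt_intervalIntegral_of_continuous
    (F' := fun ρ φ => w * (w - 1) * Real.sinh ρ * polarPow w ρ φ - polarAngularDeriv w ρ φ)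
    (fun x => (continuous_polarFlux w).comp (Continuous.prodMk_right x)) (hc1.fun_sub hc2)
    (hasDerivAt_polarFlux w) (-π) π ρ
  have h2 : Continuous (polarAngularDeriv w ρ) :=
    (continuous_polarAngularDeriv w).uncurry_left ρ
  have h4 : Continuous fun φ => w * (w - 1) * Real.sinh ρ * polarPow w ρ φ :=
    continuous_const.mul ((continuous_polarPow w).uncurry_left ρ)
  have h5 : ∫ φ in (-π)..π, (w * (w - 1) * Real.sinh ρ * polarPow w ρ φ - polarAngularDeriv w ρ φ)
      = w * (w - 1) * Real.sinh ρ * radialInt w ρ := by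
    rw [intervalIntegral.integral_sub (h4.intervalIntegrable _ _) (h2.intervalIntegrable _ _),
      integral_polarAngularDeriv, sub_zero, intervalIntegral.integral_const_mul, radialInt]
  rw [h5] at h
  exact h

theorem radialInt_zero (w : ℂ) : radialInt w 0 ≠ 0 := by
  have h : ∀ φ, polarPow w 0 φ = 1 := fun φ => by simp [polarPow, polarDenom]
  simp only [radialInt, h]
  rw [intervalIntegral.integral_const]
  have := Real.pi_pos
  simp only [Complex.real_smul, mul_one, ne_eq, Complex.ofReal_eq_zero]
  linarith

/-- Green's identity: `V = κ Im(sinh ρ · G' · conj G)` has derivative `κ² sinh ρ |G|² ≥ 0`. It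
vanishes at `0` because of `sinh`, and at any zero `ρ₁` of `G`. Hence `V` vanishes identically on
`[0, ρ₁]` and `G` vanishes on the open interval, contradicting continuity and `G(0) = 2π`. -/
theorem radialInt_ne_zero {w : ℂ} (hw : (w * (w - 1)).im ≠ 0) {ρ₁ : ℝ} (hρ : 0 ≤ ρ₁) :
    radialInt w ρ₁ ≠ 0 := by
  intro hzero
  rcases hρ.eq_or_lt with rfl | hρ
  · exact radialInt_zero w hzero
  set κ := (w * (w - 1)).im
  set V : ℝ → ℝ := fun ρ => κ * (radialFlux w ρ * starRingEnd ℂ (radialInt w ρ)).im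
  have hV : ∀ ρ, HasDerivAt V (κ ^ 2 * Real.sinh ρ * ‖radialInt w ρ‖ ^ 2) ρ := by
    intro ρ
    obtain ⟨G', hG, hH⟩ := hasDerivAt_radialInt w ρ
    have hconj : HasDerivAt (fun ρ => starRingEnd ℂ (radialInt w ρ)) (starRingEnd ℂ G') ρ :=
      (Complex.conjCLE.toContinuousLinearMap.hasFDerivAt).comp_hasDerivAt ρ hG
    have hmul := (hasDerivAt_radialFlux w ρ).mul hconj
    have him := ((Complex.imCLM.hasFDerivAt).comp_hasDerivAt ρ hmul).const_mul κ
    convert! him using 1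
    rw [hH]
    have h1 : w * (w - 1) * Real.sinh ρ * radialInt w ρ * starRingEnd ℂ (radialInt w ρ)
        + Real.sinh ρ * G' * starRingEnd ℂ G'
        = (w * (w - 1)) * ((Real.sinh ρ * ‖radialInt w ρ‖ ^ 2 : ℝ) : ℂ)
          + ((Real.sinh ρ * ‖G'‖ ^ 2 : ℝ) : ℂ) := by
      rw [mul_assoc, Complex.mul_conj, mul_assoc (Real.sinh ρ : ℂ), Complex.mul_conj,
        Complex.normSq_eq_norm_sq, Complex.normSq_eq_norm_sq]
      push_cast
      ring
    rw [h1, Complex.imCLM_apply, Complex.add_im, Complex.im_mul_ofReal, Complex.ofReal_im]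
    ring
  have hmono : MonotoneOn V (Set.Icc 0 ρ₁) := by
    refine monotoneOn_of_deriv_nonneg (convex_Icc _ _)
      (fun ρ _ => (hV ρ).continuousAt.continuousWithinAt)
      (fun ρ _ => (hV ρ).differentiableAt.differentiableWithinAt) fun ρ hρ => ?_
    rw [interior_Icc] at hρ
    rw [(hV ρ).deriv]
    have := Real.sinh_nonneg_iff.2 hρ.1.le
    positivity
  have hV0 : V 0 = 0 := by
    obtain ⟨G', -, hH⟩ := hasDerivAt_radialInt w 0
    simp [V, hH]
  have hV1 : V ρ₁ = 0 := by simp [V, hzero]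
  have hVz : ∀ ρ ∈ Set.Icc 0 ρ₁, V ρ = 0 := fun ρ h => le_antisymm
    (hV1 ▸ hmono h (Set.right_mem_Icc.2 hρ.le) h.2)
    (hV0 ▸ hmono (Set.left_mem_Icc.2 hρ.le) h h.1)
  have hG0 : ∀ ρ ∈ Set.Ioo 0 ρ₁, radialInt w ρ = 0 := by
    intro ρ h
    have h1 : HasDerivAt V 0 ρ := by
      refine (hasDerivAt_const ρ (0 : ℝ)).congr_of_eventuallyEq ?_
      filter_upwards [Icc_mem_nhds h.1 h.2] with x hx using hVz x hx
    have h2 := (hV ρ).unique h1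
    have hs := Real.sinh_pos_iff.2 h.1
    have : ‖radialInt w ρ‖ ^ 2 = 0 := by
      rcases mul_eq_zero.1 h2 with h3 | h3
      · exact absurd h3 (by positivity)
      · exact h3
    simpa using this
  have hcont : ContinuousAt (radialInt w) 0 := by
    obtain ⟨G', hG, -⟩ := hasDerivAt_radialInt w 0
    exact hG.continuousAt
  refine radialInt_zero w (tendsto_nhds_unique (hcont.tendsto.mono_left nhdsWithin_le_nhds)
    (Tendsto.congr' ?_ (tendsto_const_nhds (f := 𝓝[>] (0 : ℝ)))))
  filter_upwards [Ioo_mem_nhdsGT hρ] with ρ h using (hG0 ρ h).symm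

/-- For `n = 0` the exceptional definition at `-1/4` agrees with the general formula, because `s =
0` there. -/
theorem polyKernel_zero (lam : ℂ) (z : ℂ) (ξ : Circle) :
    polyKernel 0 lam z ξ = (diskPoisson z ξ : ℂ) ^ (sOf lam + 1 / 2) := by
  unfold polyKernel
  split_ifs with h
  · have hs : sOf (-1 / 4) = 0 := by
      have := sOf_sq (-1 / 4)
      rw [show (-1 / 4 : ℂ) + 1 / 4 = 0 by norm_num] at this
      exact pow_eq_zero_iff two_ne_zero |>.1 this
    simp [h, hs]
  · simp

theorem polyspherical_zero_eq_radialInt (lam : ℂ) {z : ℂ} (hz : ‖z‖ < 1) :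
    polyspherical 0 lam z = ((2 * π)⁻¹ : ℝ) • radialInt (sOf lam + 1 / 2)
      (Real.log ((1 + ‖z‖) / (1 - ‖z‖))) := by
  have h1 : 0 < 1 - ‖z‖ := by linarith
  have h0 := norm_nonneg z
  have h2 : 0 < 1 + ‖z‖ := by linarith
  rw [polyspherical_eq_intervalIntegral 0 lam hz, radialInt]
  congr 1
  refine intervalIntegral.integral_congr fun φ _ => ?_
  have hP : 0 < diskPoisson ((‖z‖ : ℝ) : ℂ) (Circle.exp φ) := diskPoisson_pos (by simpa using hz) _
  have hPQ : diskPoisson ((‖z‖ : ℝ) : ℂ) (Circle.exp φ)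
      = (polarDenom (Real.log ((1 + ‖z‖) / (1 - ‖z‖))) φ)⁻¹ := by
    rw [polarDenom, Real.cosh_log (by positivity), Real.sinh_log (by positivity),
      diskPoisson_ofReal_exp]
    have hcos : Real.cos φ = 1 - 2 * Real.sin (φ / 2) ^ 2 := by
      have h1 := Real.cos_two_mul (φ / 2)
      rw [mul_div_cancel₀ _ two_ne_zero] at h1
      rw [h1]
      linarith [Real.sin_sq_add_cos_sq (φ / 2)]
    rw [hcos, inv_div, eq_comm, inv_eq_one_div, div_eq_div_iff]
    · field_simp
      ring
    · have := polarDenom_pos (Real.log ((1 + ‖z‖) / (1 - ‖z‖))) φ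
      rw [polarDenom, Real.cosh_log (by positivity), Real.sinh_log (by positivity), hcos,
        inv_div] at this
      exact this.ne'
    · have : 0 ≤ 4 * ‖z‖ * Real.sin (φ / 2) ^ 2 := by positivity
      positivity
  rw [polyKernel_zero, Complex.cpow_def_of_ne_zero (Complex.ofReal_ne_zero.2 hP.ne'), polarPow,
    ← Complex.ofReal_log hP.le, hPQ, Real.log_inv]
  push_cast
  congr 1
  ring

/-- If `lam` is real then `s` is real and the integrand is positive. Otherwise `w = s + 1/2`
satisfies `w(w-1) = lam` with nonzero imaginary part, and `radialInt_ne_zero` applies. -/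
theorem polyspherical_zero_ne_zero {lam : ℂ} (hlam : ¬(lam.im = 0 ∧ lam.re < -1 / 4)) {z : ℂ}
    (hz : ‖z‖ < 1) : polyspherical 0 lam z ≠ 0 := by
  have h1 : 0 < 1 - ‖z‖ := by linarith
  have h0 := norm_nonneg z
  have hsq := sOf_sq lam
  have hlam' : (sOf lam + 1 / 2) * (sOf lam + 1 / 2 - 1) = lam := by
    linear_combination hsq
  by_cases him : lam.im = 0
  · have hs : (sOf lam).im = 0 := by
      by_cases h : lam = -1 / 4
      · rw [h, show (-1 / 4 : ℂ) + 1 / 4 = 0 by norm_num] at hsq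
        rw [h, pow_eq_zero_iff two_ne_zero |>.1 hsq, Complex.zero_im]
      · have hpos := sOf_re_pos hlam h
        have h2 := congrArg Complex.im hsq
        rw [sq, Complex.mul_im, Complex.add_im, him] at h2
        norm_num at h2
        have h3 : (sOf lam).re * (sOf lam).im = 0 := by linarith
        exact (mul_eq_zero.1 h3).resolve_left hpos.ne'
    have hre : sOf lam + 1 / 2 = (((sOf lam).re + 1 / 2 : ℝ) : ℂ) := by
      apply Complex.ext <;> simp [hs]
    have hK : ∀ ξ, polyKernel 0 lam z ξ
        = ((diskPoisson z ξ ^ ((sOf lam).re + 1 / 2) : ℝ) : ℂ) := fun ξ => by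
      rw [polyKernel_zero, hre, Complex.ofReal_cpow (diskPoisson_pos hz ξ).le]
    unfold polyspherical
    simp only [hK]
    rw [integral_complex_ofReal, Complex.ofReal_ne_zero]
    have hc : Continuous fun ξ => diskPoisson z ξ ^ ((sOf lam).re + 1 / 2) :=
      (continuous_diskPoisson hz).rpow_const fun ξ => Or.inl (diskPoisson_pos hz ξ).ne'
    have hp : ∀ ξ, 0 < diskPoisson z ξ ^ ((sOf lam).re + 1 / 2) := fun ξ =>
      Real.rpow_pos_of_pos (diskPoisson_pos hz ξ) _
    refine ((integral_pos_iff_support_of_nonneg (fun ξ => (hp ξ).le)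
      (hc.integrable_of_hasCompactSupport (HasCompactSupport.of_compactSpace _))).2 ?_).ne'
    rw [show Function.support (fun ξ => diskPoisson z ξ ^ ((sOf lam).re + 1 / 2)) = Set.univ from
      Set.eq_univ_of_forall fun ξ => (hp ξ).ne']
    simp
  · rw [polyspherical_zero_eq_radialInt lam hz]
    refine smul_ne_zero (by have := Real.pi_pos; positivity) (radialInt_ne_zero ?_ ?_)
    · rwa [hlam']
    · exact Real.log_nonneg ((one_le_div h1).2 (by linarith))

/-! ### Radial majorants and the two limit theorems. -/

/-- An approximate identity on the half line, up to normalisation. -/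
def approxKernel (p δ t : ℝ) : ℝ := δ ^ p * (δ + t) ^ (-(1 + p))

theorem approxKernel_nonneg (p : ℝ) {δ t : ℝ} (hδ : 0 ≤ δ) (ht : 0 ≤ t) :
    0 ≤ approxKernel p δ t :=
  mul_nonneg (Real.rpow_nonneg hδ _) (Real.rpow_nonneg (add_nonneg hδ ht) _)

theorem continuousOn_approxKernel (p : ℝ) {δ : ℝ} (hδ : 0 < δ) :
    ContinuousOn (approxKernel p δ) (Set.Ici 0) :=
  continuousOn_const.mul ((by fun_prop : ContinuousOn (fun t => δ + t) (Set.Ici 0)).rpow_const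
    fun t ht => Or.inl (add_pos_of_pos_of_nonneg hδ ht).ne')

theorem antitoneOn_approxKernel {p δ : ℝ} (hp : 0 ≤ p) (hδ : 0 < δ) :
    AntitoneOn (approxKernel p δ) (Set.Ici 0) := fun s hs t _ hst =>
  mul_le_mul_of_nonneg_left (Real.rpow_le_rpow_of_nonpos
    (add_pos_of_pos_of_nonneg hδ hs) (by linarith) (by linarith)) (Real.rpow_nonneg hδ.le _)

theorem intervalIntegrable_approxKernel (p : ℝ) {δ : ℝ} (hδ : 0 < δ) :
    IntervalIntegrable (approxKernel p δ) volume 0 2 :=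
  ((continuousOn_approxKernel p hδ).mono fun t ht => by
    rw [Set.uIcc_of_le zero_le_two] at ht
    exact ht.1).intervalIntegrable

theorem integral_approxKernel_le {p δ : ℝ} (hp : 0 < p) (hδ : 0 < δ) :
    ∫ t in (0 : ℝ)..2, approxKernel p δ t ≤ 1 / p := by
  unfold approxKernel
  rw [intervalIntegral.integral_const_mul,
    intervalIntegral.integral_comp_add_left (fun x => x ^ (-(1 + p))) δ, add_zero,
    integral_rpow (Or.inr ⟨by linarith, by
      rw [Set.uIcc_of_le (by linarith)]
      exact fun h => absurd h.1 (not_le.2 hδ)⟩),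
    show -(1 + p) + 1 = -p by ring, div_neg, ← neg_div, ← mul_div_assoc]
  refine div_le_div_of_nonneg_right ?_ hp.le
  have h1 : δ ^ p * δ ^ (-p) = 1 := by
    rw [← Real.rpow_add hδ, add_neg_cancel, Real.rpow_zero]
  have h2 : 0 ≤ δ ^ p * (δ + 2) ^ (-p) := by positivity
  linarith

theorem tendsto_approxKernel {p : ℝ} (hp : 0 < p) {ε : ℝ} (hε : 0 < ε) :
    Tendsto (fun δ => approxKernel p δ ε) (𝓝[>] 0) (𝓝 0) := by
  have h1 : ContinuousAt (fun δ => approxKernel p δ ε) 0 := by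
    refine ContinuousAt.mul (Real.continuousAt_rpow_const _ _ (Or.inr hp.le)) ?_
    refine ContinuousAt.rpow_const (by fun_prop) (Or.inl ?_)
    simpa using hε.ne'
  have h2 := h1.tendsto
  rw [show approxKernel p 0 ε = 0 by rw [approxKernel, Real.zero_rpow hp.ne', zero_mul]] at h2
  exact h2.mono_left nhdsWithin_le_nhds

theorem integral_inv_add_le {δ : ℝ} (hδ : 0 < δ) (hδ' : δ ≤ 1) :
    ∫ t in (0 : ℝ)..2, (δ + t)⁻¹ ≤ Real.log 3 - Real.log δ := by
  rw [intervalIntegral.integral_comp_add_left (fun x => x⁻¹) δ, add_zero,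
    integral_inv_of_pos hδ (by linarith), Real.log_div (by linarith) hδ.ne']
  have := Real.log_le_log (by linarith) (show δ + 2 ≤ 3 by linarith)
  linarith

theorem one_sub_norm_add_dist_le {z : ℂ} {ζ : Circle} {M : ℝ} (hM : 0 ≤ M)
    (h : ‖z - ζ‖ ≤ M * (1 - ‖z‖)) (ξ : Circle) :
    1 - ‖z‖ + dist ξ ζ ≤ (2 + M) * ‖(ξ : ℂ) - z‖ := by
  have h1 := one_sub_norm_le_norm_sub z ξ
  have h2 : dist ξ ζ ≤ ‖(ξ : ℂ) - z‖ + ‖z - ζ‖ := by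
    rw [dist_circle_eq]
    exact norm_sub_le_norm_sub_add_norm_sub _ _ _
  nlinarith

/-- Meant for `M` growing like `L = -log(1-|z|)`, where the cruder `one_sub_norm_add_dist_le` would
cost a factor `M` times a logarithmic mass, that is `L²`. Far from `ζ` (`dist ξ ζ ≥ 2M(1-|z|)`) the
constant `3` is free of `M`; nearby, `1/(1-|z|)` is bounded by `8M` times a kernel of mass at most
`1`. Both masses are then `O(L)`. -/
theorem inv_norm_sub_le {z : ℂ} {ζ : Circle} {M : ℝ} (hz : ‖z‖ < 1) (hM : 0 < M)
    (h : ‖z - ζ‖ ≤ M * (1 - ‖z‖)) (ξ : Circle) :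
    ‖(ξ : ℂ) - z‖⁻¹ ≤ 3 * (1 - ‖z‖ + dist ξ ζ)⁻¹
      + 8 * M * approxKernel 1 (2 * M * (1 - ‖z‖)) (dist ξ ζ) := by
  have hδ : 0 < 1 - ‖z‖ := by linarith
  have h1 := one_sub_norm_le_norm_sub z ξ
  have hd : 0 < ‖(ξ : ℂ) - z‖ := by linarith
  have h2 : dist ξ ζ ≤ ‖(ξ : ℂ) - z‖ + ‖z - ζ‖ := by
    rw [dist_circle_eq]
    exact norm_sub_le_norm_sub_add_norm_sub _ _ _
  have ht : 0 ≤ dist ξ ζ := dist_nonneg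
  generalize dist ξ ζ = t at *
  generalize 1 - ‖z‖ = δ at *
  generalize ‖(ξ : ℂ) - z‖ = d at *
  have hm : 0 < 2 * M * δ := by positivity
  rcases le_or_gt (2 * M * δ) t with hc | hc
  · have h3 : d⁻¹ ≤ 3 * (δ + t)⁻¹ := by
      rw [← div_eq_mul_inv, inv_eq_one_div, div_le_div_iff₀ hd (by positivity)]
      linarith
    have h4 := approxKernel_nonneg 1 hm.le ht
    have h5 : 0 ≤ 8 * M * approxKernel 1 (2 * M * δ) t := by positivity
    linarith
  · have h3 : 0 ≤ 3 * (δ + t)⁻¹ := by positivity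
    have h4 : d⁻¹ ≤ δ⁻¹ := inv_anti₀ hδ h1
    have h5 : δ⁻¹ ≤ 8 * M * approxKernel 1 (2 * M * δ) t := by
      have h6 : approxKernel 1 (2 * M * δ) t = 2 * M * δ / (2 * M * δ + t) ^ 2 := by
        rw [approxKernel, Real.rpow_one, Real.rpow_neg (by positivity), one_add_one_eq_two,
          Real.rpow_two, div_eq_mul_inv]
      rw [h6, ← mul_div_assoc, inv_eq_one_div, div_le_div_iff₀ hδ (by positivity)]
      nlinarith
    linarith

section

variable {F : Filter ℂ} {ν : ComplexMeasure Circle} {ζ : Circle} {c : ℂ} {μ : Measure Circle}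
  [IsFiniteMeasure μ]

/-- With `δ = 1 - |z|`, the bound `P ≤ 2(2+M)² δ/(δ+t)²` raised to the power `σ + 1/2` is a multiple
of `δ^(1/2-σ)` times `approxKernel (2σ)`. The powers of `δ` and of `log δ` cancel against the lower
bound for `Φ_n`. -/
theorem tendsto_polyPoisson_div_of_ne (n : ℕ) {lam : ℂ} (hlam : lam ≠ -1 / 4)
    (hs : 0 < (sOf lam).re)
    (hμ : Tendsto (fun ε => μ (Metric.closedBall ζ ε) / arcLength (Metric.closedBall ζ ε))
      (𝓝[>] 0) (𝓝 0))
    (hν : ∀ g : Circle → ℂ, Continuous g →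
      ‖ν.integral g (ContinuousLinearMap.mul ℝ ℂ) - c * ∫ ξ, g ξ ∂arcLength‖ₑ ≤ ∫⁻ ξ, ‖g ξ‖ₑ ∂μ)
    (hF : Tendsto (fun z : ℂ => 1 - ‖z‖) F (𝓝[>] 0)) {M : ℝ} (hM : 0 ≤ M)
    (hFM : ∀ᶠ z in F, ‖z - (ζ : ℂ)‖ ≤ M * (1 - ‖z‖)) :
    Tendsto (fun z => polyPoisson n lam ν z / polyspherical n lam z) F (𝓝 c) := by
  obtain ⟨b, hb, hlow⟩ := exists_le_norm_polyspherical n hlam hs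
  have hlow' := hF.eventually hlow
  set σ := (sOf lam).re
  have hsmall : ∀ᶠ z in F, 1 - ‖z‖ ∈ Set.Ioo (0 : ℝ) (1 / 4) :=
    hF.eventually (Ioo_mem_nhdsGT (by norm_num))
  set C₀ : ℝ := 1 / ((n.factorial : ℝ) * (2 * ‖sOf lam‖) ^ n)
  have hC₀ : 0 ≤ C₀ := by positivity
  set C : ℝ := C₀ * 2 ^ n * (2 * (2 + M) ^ 2) ^ (σ + 1 / 2) / b
  have hC : 0 ≤ C := by positivity
  refine tendsto_integral_div_of_radial_majorant hμ hν (N := polyKernel n lam)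
    (k := fun z t => C * approxKernel (2 * σ) (1 - ‖z‖) t) (A := C * (1 / (2 * σ)))
    ?_ ?_ ?_ ?_ ?_ ?_ ?_ ?_
  · filter_upwards [hsmall] with z hz
    exact continuous_polyKernel n lam (by linarith [hz.1])
  · filter_upwards [hsmall, hlow'] with z hz hl
    have hL : 0 < -Real.log (1 - ‖z‖) := neg_pos.2 (Real.log_neg hz.1 (by linarith [hz.2]))
    have hδ := hz.1
    refine norm_pos_iff.1 (lt_of_lt_of_le ?_ (hl z (by ring)))
    positivity
  · filter_upwards [hsmall] with z hz t ht
    exact mul_nonneg hC (approxKernel_nonneg _ hz.1.le ht)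
  · filter_upwards [hsmall] with z hz
    exact continuousOn_const.mul (continuousOn_approxKernel _ hz.1)
  · filter_upwards [hsmall] with z hz s hs' t ht hst
    exact mul_le_mul_of_nonneg_left
      (antitoneOn_approxKernel (by positivity) hz.1 hs' ht hst) hC
  · filter_upwards [hsmall, hlow', hFM] with z hz hl hzM ξ
    have hδ := hz.1
    have hz1 : ‖z‖ < 1 := by linarith
    have hL : 0 < -Real.log (1 - ‖z‖) := neg_pos.2 (Real.log_neg hz.1 (by linarith [hz.2]))
    have hlog := abs_log_diskPoisson_le hz1 hz.2.le ξ
    have hd := one_sub_norm_add_dist_le hM hzM ξ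
    have hP0 := diskPoisson_pos hz1 ξ
    have ht : 0 ≤ dist ξ ζ := dist_nonneg
    have hP : diskPoisson z ξ
        ≤ 2 * (2 + M) ^ 2 * ((1 - ‖z‖) / (1 - ‖z‖ + dist ξ ζ) ^ 2) := by
      refine (diskPoisson_le hz1 ξ).trans ?_
      have hpos := hδ.trans_le (one_sub_norm_le_norm_sub z ξ)
      rw [← mul_div_assoc, div_le_div_iff₀ (by positivity) (by positivity)]
      have := pow_le_pow_left₀ (by positivity) hd 2
      rw [mul_pow] at this
      nlinarith
    have hPow : diskPoisson z ξ ^ (σ + 1 / 2) ≤ (2 * (2 + M) ^ 2) ^ (σ + 1 / 2)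
        * ((1 - ‖z‖) ^ (1 / 2 - σ) * approxKernel (2 * σ) (1 - ‖z‖) (dist ξ ζ)) := by
      refine (Real.rpow_le_rpow hP0.le hP (by positivity)).trans_eq ?_
      rw [Real.mul_rpow (by positivity) (by positivity), Real.div_rpow hδ.le (by positivity),
        approxKernel, ← mul_assoc ((1 - ‖z‖) ^ (1 / 2 - σ)), ← Real.rpow_add hδ,
        ← Real.rpow_natCast (1 - ‖z‖ + dist ξ ζ) 2, ← Real.rpow_mul (by positivity),
        Real.rpow_neg (by positivity), ← div_eq_mul_inv,
        show 1 / 2 - σ + 2 * σ = σ + 1 / 2 by ring,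
        show ((2 : ℕ) : ℝ) * (σ + 1 / 2) = 1 + 2 * σ by push_cast; ring]
    rw [norm_polyKernel_of_ne n hlam hz1 ξ]
    have hK := approxKernel_nonneg (2 * σ) hδ.le ht
    calc C₀ * |Real.log (diskPoisson z ξ)| ^ n * diskPoisson z ξ ^ (σ + 1 / 2)
        ≤ C₀ * (2 * -Real.log (1 - ‖z‖)) ^ n * ((2 * (2 + M) ^ 2) ^ (σ + 1 / 2)
          * ((1 - ‖z‖) ^ (1 / 2 - σ) * approxKernel (2 * σ) (1 - ‖z‖) (dist ξ ζ))) := by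
          gcongr
      _ = b * (-Real.log (1 - ‖z‖)) ^ n * (1 - ‖z‖) ^ (1 / 2 - σ)
          * (C * approxKernel (2 * σ) (1 - ‖z‖) (dist ξ ζ)) := by
          simp only [C]
          rw [mul_pow]
          field_simp
      _ ≤ _ := mul_le_mul_of_nonneg_right (hl z (by ring)) (mul_nonneg hC hK)
  · filter_upwards [hsmall] with z hz
    rw [intervalIntegral.integral_const_mul]
    exact mul_le_mul_of_nonneg_left (integral_approxKernel_le (by positivity) hz.1) hC
  · intro ε hε
    have := ((tendsto_approxKernel (by positivity : 0 < 2 * σ) hε).comp hF).const_mul C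
    rwa [mul_zero] at this

theorem tendsto_polyPoisson_div_neg_quarter (n : ℕ)
    (hμ : Tendsto (fun ε => μ (Metric.closedBall ζ ε) / arcLength (Metric.closedBall ζ ε))
      (𝓝[>] 0) (𝓝 0))
    (hν : ∀ g : Circle → ℂ, Continuous g →
      ‖ν.integral g (ContinuousLinearMap.mul ℝ ℂ) - c * ∫ ξ, g ξ ∂arcLength‖ₑ ≤ ∫⁻ ξ, ‖g ξ‖ₑ ∂μ)
    (hF : Tendsto (fun z : ℂ => 1 - ‖z‖) F (𝓝[>] 0)) {B : ℝ} (hB : 0 < B)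
    (hFM : ∀ᶠ z in F, ‖z - (ζ : ℂ)‖ ≤ B * -Real.log (1 - ‖z‖) * (1 - ‖z‖)) :
    Tendsto (fun z => polyPoisson n (-1 / 4) ν z / polyspherical n (-1 / 4) z) F (𝓝 c) := by
  obtain ⟨b, hb, hlow⟩ := exists_le_norm_polyspherical_neg_quarter n
  have hlow' := hF.eventually hlow
  have hsmall : ∀ᶠ z in F, 1 - ‖z‖ ∈ Set.Ioo (0 : ℝ) (1 / 4) :=
    hF.eventually (Ioo_mem_nhdsGT (by norm_num))
  have hLtop : Tendsto (fun z : ℂ => -Real.log (1 - ‖z‖)) F atTop :=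
    tendsto_neg_atBot_atTop.comp (Real.tendsto_log_nhdsGT_zero.comp hF)
  have hL1 : ∀ᶠ z : ℂ in F, 1 ≤ -Real.log (1 - ‖z‖) := hLtop.eventually_ge_atTop 1
  set C₀ : ℝ := 1 / ((2 * n).factorial : ℝ)
  have hC₀ : 0 ≤ C₀ := by positivity
  set C : ℝ := C₀ * 2 ^ (2 * n) * 2 ^ (1 / 2 : ℝ) / b
  have hC : 0 ≤ C := by positivity
  -- The width of the near region in `inv_norm_sub_le` with `M = B L`; it still tends to `0` since
  -- `δ log δ → 0`.
  set w : ℂ → ℝ := fun z => 2 * (B * -Real.log (1 - ‖z‖)) * (1 - ‖z‖)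
  have hw : Tendsto w F (𝓝[>] 0) := by
    refine tendsto_nhdsWithin_iff.2 ⟨?_, ?_⟩
    · have h1 := ((tendsto_log_mul_rpow_nhdsGT_zero one_pos).comp hF).const_mul (-2 * B)
      rw [mul_zero] at h1
      refine h1.congr fun z => ?_
      simp only [Function.comp_apply, Real.rpow_one, w]
      ring
    · filter_upwards [hsmall, hL1] with z hz hL
      have := hz.1
      exact mul_pos (by positivity) this
  have hw0 : ∀ᶠ z in F, 0 < w z := (tendsto_nhdsWithin_iff.1 hw).2
  -- Both terms of `inv_norm_sub_le` are divided by `L`, the surplus logarithm of `Φ_n`. The first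
  -- then has mass at most `3(log 3 + 1)` once `L ≥ 1`, and the second at most `8B`.
  set k : ℂ → ℝ → ℝ := fun z t =>
    C * (3 * ((-Real.log (1 - ‖z‖))⁻¹ * (1 - ‖z‖ + t)⁻¹) + 8 * B * approxKernel 1 (w z) t)
  refine tendsto_integral_div_of_radial_majorant hμ hν (N := polyKernel n (-1 / 4))
    (k := k) (A := C * (3 * (Real.log 3 + 1) + 8 * B)) ?_ ?_ ?_ ?_ ?_ ?_ ?_ ?_
  · filter_upwards [hsmall] with z hz
    exact continuous_polyKernel n _ (by linarith [hz.1])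
  · filter_upwards [hsmall, hlow', hL1] with z hz hl hL
    have hδ := hz.1
    refine norm_pos_iff.1 (lt_of_lt_of_le ?_ (hl z (by ring)))
    positivity
  · filter_upwards [hsmall, hL1, hw0] with z hz hL hwz t ht
    have := approxKernel_nonneg 1 hwz.le ht
    have hδ := hz.1
    positivity
  · filter_upwards [hsmall, hw0] with z hz hwz
    refine continuousOn_const.mul ((continuousOn_const.mul (continuousOn_const.mul ?_)).add
      (continuousOn_const.mul (continuousOn_approxKernel 1 hwz)))
    exact ContinuousOn.inv₀ (by fun_prop) fun t ht => (add_pos_of_pos_of_nonneg hz.1 ht).ne'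
  · filter_upwards [hsmall, hL1, hw0] with z hz hL hwz s hs t ht hst
    have h1 := antitoneOn_approxKernel zero_le_one hwz hs ht hst
    have h2 : (1 - ‖z‖ + t)⁻¹ ≤ (1 - ‖z‖ + s)⁻¹ :=
      inv_anti₀ (add_pos_of_pos_of_nonneg hz.1 hs) (by linarith)
    simp only [k]
    gcongr
  · filter_upwards [hsmall, hlow', hFM, hL1] with z hz hl hzM hL ξ
    have hδ := hz.1
    have hz1 : ‖z‖ < 1 := by linarith
    have hlog := abs_log_diskPoisson_le hz1 hz.2.le ξ
    have hP0 := diskPoisson_pos hz1 ξ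
    have hpos := hδ.trans_le (one_sub_norm_le_norm_sub z ξ)
    have hinv := inv_norm_sub_le hz1 (by positivity) hzM ξ
    have hPow : diskPoisson z ξ ^ (1 / 2 : ℝ)
        ≤ 2 ^ (1 / 2 : ℝ) * (1 - ‖z‖) ^ (1 / 2 : ℝ) * ‖(ξ : ℂ) - z‖⁻¹ := by
      refine (Real.rpow_le_rpow hP0.le (diskPoisson_le hz1 ξ) (by positivity)).trans_eq ?_
      rw [Real.div_rpow (by positivity) (by positivity), Real.mul_rpow zero_le_two hδ.le,
        ← Real.sqrt_eq_rpow (‖(ξ : ℂ) - z‖ ^ 2), Real.sqrt_sq hpos.le, div_eq_mul_inv]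
    have hk0 : 0 ≤ k z (dist ξ ζ) := by
      have h1 := approxKernel_nonneg 1 (show 0 ≤ w z by simp only [w]; positivity)
        (dist_nonneg (x := ξ) (y := ζ))
      have h2 := dist_nonneg (x := ξ) (y := ζ)
      positivity
    rw [polyKernel_neg_quarter n hz1 ξ, Complex.norm_real, Real.norm_of_nonneg (by positivity)]
    calc C₀ * |Real.log (diskPoisson z ξ)| ^ (2 * n) * diskPoisson z ξ ^ (1 / 2 : ℝ)
        ≤ C₀ * (2 * -Real.log (1 - ‖z‖)) ^ (2 * n) * (2 ^ (1 / 2 : ℝ) * (1 - ‖z‖) ^ (1 / 2 : ℝ)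
          * (3 * (1 - ‖z‖ + dist ξ ζ)⁻¹
            + 8 * (B * -Real.log (1 - ‖z‖)) * approxKernel 1 (w z) (dist ξ ζ))) := by
          refine mul_le_mul (by gcongr) (hPow.trans ?_) (by positivity) (by positivity)
          exact mul_le_mul_of_nonneg_left hinv (by positivity)
      _ = b * (-Real.log (1 - ‖z‖)) ^ (2 * n + 1) * (1 - ‖z‖) ^ (1 / 2 : ℝ)
          * k z (dist ξ ζ) := by
          have hLne : -Real.log (1 - ‖z‖) ≠ 0 := by positivity
          simp only [k, C]
          rw [mul_pow]
          generalize -Real.log (1 - ‖z‖) = L at *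
          field_simp
          ring
      _ ≤ _ := mul_le_mul_of_nonneg_right (hl z (by ring)) hk0
  · filter_upwards [hsmall, hL1, hw0] with z hz hL hwz
    have hδ := hz.1
    have hi : IntervalIntegrable (fun t => (1 - ‖z‖ + t)⁻¹) volume 0 2 := by
      refine (ContinuousOn.inv₀ (by fun_prop) fun t ht => ?_).intervalIntegrable
      rw [Set.uIcc_of_le zero_le_two] at ht
      linarith [ht.1]
    simp only [k]
    rw [intervalIntegral.integral_const_mul, intervalIntegral.integral_add
      ((hi.const_mul _).const_mul _) ((intervalIntegrable_approxKernel 1 hwz).const_mul _),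
      intervalIntegral.integral_const_mul, intervalIntegral.integral_const_mul,
      intervalIntegral.integral_const_mul]
    have h1 := integral_approxKernel_le one_pos hwz
    rw [div_one] at h1
    have h2 := integral_inv_add_le hδ (by linarith [hz.2])
    have h3 : (-Real.log (1 - ‖z‖))⁻¹ * ∫ t in (0 : ℝ)..2, (1 - ‖z‖ + t)⁻¹ ≤ Real.log 3 + 1 := by
      rw [inv_mul_le_iff₀ (by positivity)]
      have : 0 ≤ Real.log 3 := Real.log_nonneg (by norm_num)
      nlinarith
    refine mul_le_mul_of_nonneg_left (add_le_add (by linarith) ?_) hC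
    nlinarith
  · intro ε hε
    have h1 := (tendsto_approxKernel one_pos hε).comp hw
    have h2 : Tendsto (fun z : ℂ => (-Real.log (1 - ‖z‖))⁻¹) F (𝓝 0) :=
      tendsto_inv_atTop_zero.comp hLtop
    have h3 : Tendsto (fun z : ℂ => (1 - ‖z‖ + ε)⁻¹) F (𝓝 (0 + ε)⁻¹) :=
      ((tendsto_nhdsWithin_iff.1 hF).1.add_const ε).inv₀ (by simpa using hε.ne')
    have h4 := (((h2.mul h3).const_mul 3).add (h1.const_mul (8 * B))).const_mul C
    simpa [k] using h4

end

/-! ### Conclusion: convergence almost everywhere and the zero-free annulus. -/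

theorem tendsto_one_sub_norm_nhdsWithin {s : Set ℂ} (hs : ∀ z ∈ s, ‖z‖ < 1) (ζ : Circle) :
    Tendsto (fun z : ℂ => 1 - ‖z‖) (𝓝[s] (ζ : ℂ)) (𝓝[>] 0) := by
  refine tendsto_nhdsWithin_iff.2 ⟨?_, ?_⟩
  · have h : ContinuousAt (fun z : ℂ => 1 - ‖z‖) ζ := by fun_prop
    have h1 := h.tendsto
    rw [Circle.norm_coe, sub_self] at h1
    exact h1.mono_left nhdsWithin_le_nhds
  · filter_upwards [self_mem_nhdsWithin] with z hz
    exact sub_pos.2 (hs z hz)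

/-- Once `1 - |z| < 1/e`, the distance `ρ(z,0)` is at least `1` and its logarithm is nonnegative.
Thus enlarged-admissible convergence implies admissible convergence. -/
theorem eventually_mem_enlargedRegion (a : ℝ) (ζ : Circle) :
    ∀ᶠ z in 𝓝[admissibleRegion a ζ] (ζ : ℂ), z ∈ enlargedRegion a ζ := by
  have h := tendsto_one_sub_norm_nhdsWithin (s := admissibleRegion a ζ) (fun z hz => hz.1) ζ
  filter_upwards [self_mem_nhdsWithin,
    h.eventually (Ioo_mem_nhdsGT (by positivity : (0 : ℝ) < Real.exp (-1)))] with z hz hδ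
  have h0 := norm_nonneg z
  have hδ0 := hδ.1
  have hlt : 1 - ‖z‖ < 1 := hδ.2.trans (by simp)
  refine ⟨hz.1, fun hz0 => by simp [hz0] at hlt, hz.2.trans ?_⟩
  have h1 : 1 ≤ hypDist z 0 := by
    rw [hypDist_zero_right, Real.log_div (by positivity) hδ0.ne']
    have h2 := Real.log_nonneg (show (1 : ℝ) ≤ 1 + ‖z‖ by linarith)
    have h3 := Real.log_lt_log hδ0 hδ.2
    rw [Real.log_exp] at h3
    linarith
  have := Real.log_nonneg h1
  linarith

theorem convergesEnlargedAdmissibly_neg_quarter (n : ℕ) (ν : ComplexMeasure Circle) :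
    ∀ᵐ ζ ∂arcLength, ConvergesEnlargedAdmissibly
      (fun z => polyPoisson n (-1 / 4) ν z / polyspherical n (-1 / 4) z) ζ
      (ν.rnDeriv arcLength ζ) := by
  filter_upwards [ae_exists_dominating_measure ν] with ζ ⟨μ, _, hμ, hν⟩ a ha
  have hF := tendsto_one_sub_norm_nhdsWithin (s := enlargedRegion a ζ) (fun z hz => hz.1) ζ
  -- The constant `16` is `8` doubled, since `log 2 + L ≤ 2L` as soon as `L ≥ log 2`.
  refine tendsto_polyPoisson_div_neg_quarter n hμ hν hF
    (by positivity : 0 < 16 * Real.exp (a + 1)) ?_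
  have hL : Tendsto (fun z : ℂ => -Real.log (1 - ‖z‖)) (𝓝[enlargedRegion a ζ] (ζ : ℂ)) atTop :=
    tendsto_neg_atBot_atTop.comp (Real.tendsto_log_nhdsGT_zero.comp hF)
  filter_upwards [self_mem_nhdsWithin, hL.eventually_ge_atTop (Real.log 2)] with z hz hL
  have hδ : 0 < 1 - ‖z‖ := sub_pos.2 hz.1
  refine (norm_sub_le_of_mem_enlargedRegion hz).trans (mul_le_mul_of_nonneg_right ?_ hδ.le)
  have := Real.exp_pos (a + 1)
  nlinarith

theorem convergesAdmissibly (n : ℕ) {lam : ℂ} (hlam : ¬(lam.im = 0 ∧ lam.re < -1 / 4))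
    (ν : ComplexMeasure Circle) :
    ∀ᵐ ζ ∂arcLength, ConvergesAdmissibly
      (fun z => polyPoisson n lam ν z / polyspherical n lam z) ζ (ν.rnDeriv arcLength ζ) := by
  by_cases h : lam = -1 / 4
  · subst h
    filter_upwards [convergesEnlargedAdmissibly_neg_quarter n ν] with ζ hζ a ha
    exact (hζ a ha).mono_left (nhdsWithin_le_iff.2 (eventually_mem_enlargedRegion a ζ))
  · filter_upwards [ae_exists_dominating_measure ν] with ζ ⟨μ, _, hμ, hν⟩ a ha
    refine tendsto_polyPoisson_div_of_ne n h (sOf_re_pos hlam h) hμ hν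
      (tendsto_one_sub_norm_nhdsWithin (fun z hz => hz.1) ζ)
      (by positivity : 0 ≤ 8 * Real.exp (a + 1)) ?_
    filter_upwards [self_mem_nhdsWithin] with z hz
    exact norm_sub_le_of_hypDistSegment_le hz.1 hz.2

theorem eventually_polyspherical_ne_zero (n : ℕ) {lam : ℂ}
    (hlam : ¬(lam.im = 0 ∧ lam.re < -1 / 4)) :
    ∀ᶠ δ in 𝓝[>] (0 : ℝ), ∀ z : ℂ, ‖z‖ = 1 - δ → polyspherical n lam z ≠ 0 := by
  by_cases h : lam = -1 / 4
  · subst h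
    obtain ⟨b, hb, hlow⟩ := exists_le_norm_polyspherical_neg_quarter n
    filter_upwards [hlow, Ioo_mem_nhdsGT one_pos] with δ hl hδ z hz
    have hL : 0 < -Real.log δ := neg_pos.2 (Real.log_neg hδ.1 hδ.2)
    have hδ0 := hδ.1
    exact norm_pos_iff.1 (lt_of_lt_of_le (by positivity) (hl z hz))
  · obtain ⟨b, hb, hlow⟩ := exists_le_norm_polyspherical n h (sOf_re_pos hlam h)
    filter_upwards [hlow, Ioo_mem_nhdsGT one_pos] with δ hl hδ z hz
    have hL : 0 < -Real.log δ := neg_pos.2 (Real.log_neg hδ.1 hδ.2)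
    have hδ0 := hδ.1
    exact norm_pos_iff.1 (lt_of_lt_of_le (by positivity) (hl z hz))

theorem exists_radius_polyspherical_ne_zero (n : ℕ) {lam : ℂ}
    (hlam : ¬(lam.im = 0 ∧ lam.re < -1 / 4)) :
    ∃ r : ℝ, 0 ≤ r ∧ r < 1 ∧ (n = 0 → r = 0) ∧
      ∀ z : ℂ, r ≤ ‖z‖ → ‖z‖ < 1 → polyspherical n lam z ≠ 0 := by
  rcases eq_or_ne n 0 with rfl | hn
  · exact ⟨0, le_rfl, one_pos, fun _ => rfl, fun z _ hz => polyspherical_zero_ne_zero hlam hz⟩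
  obtain ⟨u, hu, hsub⟩ :=
    mem_nhdsGT_iff_exists_Ioo_subset.1 (eventually_polyspherical_ne_zero n hlam)
  have hu' : (0 : ℝ) < u := hu
  -- Halving `u` keeps `1 - |z|` strictly inside the open interval even when `|z|` equals the
  -- radius.
  refine ⟨max 0 (1 - u / 2), le_max_left _ _, max_lt one_pos (by linarith),
    fun h => absurd h hn, fun z hz hz1 => ?_⟩
  have h1 := (le_max_right _ _).trans hz
  exact hsub (⟨by linarith, by linarith⟩ : 1 - ‖z‖ ∈ Set.Ioo 0 u) z (by ring)

end
end HypDisk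

theorem mainTheorem5 (n : ℕ) (lam : ℂ) (hlam : ¬ (lam.im = 0 ∧ lam.re < -1 / 4))
    (ν : ComplexMeasure Circle) :
    (∃ r : ℝ, 0 ≤ r ∧ r < 1 ∧ (n = 0 → r = 0) ∧
      ∀ z : ℂ, r ≤ ‖z‖ → ‖z‖ < 1 → HypDisk.polyspherical n lam z ≠ 0) ∧
    (∀ᵐ ξ ∂HypDisk.arcLength, HypDisk.ConvergesAdmissibly
      (fun z => HypDisk.polyPoisson n lam ν z / HypDisk.polyspherical n lam z) ξ
      (ν.rnDeriv HypDisk.arcLength ξ)) ∧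
    (lam = -1 / 4 → ∀ᵐ ξ ∂HypDisk.arcLength, HypDisk.ConvergesEnlargedAdmissibly
      (fun z => HypDisk.polyPoisson n lam ν z / HypDisk.polyspherical n lam z) ξ
      (ν.rnDeriv HypDisk.arcLength ξ)) :=
  ⟨HypDisk.exists_radius_polyspherical_ne_zero n hlam, HypDisk.convergesAdmissibly n hlam ν,
    fun h => h ▸ HypDisk.convergesEnlargedAdmissibly_neg_quarter n ν⟩
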